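/- **Setting.** Let $I=[0,1]$. A $\Box$-set $X$ is a sequence of sets $X_n$ ($n\ge 0$) of $n$-cubes with face maps $d_i^\alpha:X_n\to X_{n-1}$ ($\alpha\in\{0,1\}$, $1\le i\le n$) such that $d_i^\alpha d_j^\beta=d_{j-1}^\beta d_i^\alpha$ for $i<j$; $|X|$ is its geometric realization, with points $[c;z]$, $c\in X_n$, $z\in I^n$. A partition $J=[J_0|J_*|J_1]$ of $\{1,\dots,n\}$ describes the face $\{0\}^{J_0}\times I^{J_*}\times\{1\}^{J_1}$ of $I^n$, with collar $C_J=[0,\frac12[^{J_0}\times I^{J_*}\times]\frac12,1]^{J_1}$; for $c\in X_n$ it gives an iterated face $d_Jc$ of $c$ ($c$ itself included). For a cube $d$ of $X$ let $C(d,X)\subseteq|X|$ be the set of all points $[c;z]$ with $z\in C_J$ for some $J$ such that $d_Jc$ is an iterated face of $d$; for a vertex $v$, $st(v)=C(v,X)$. $X$ is *proper* if there is at most one cube with given bottom and top vertices, and *non-self-linked* if for each $c\in X_n$ different $J$ give different faces $d_Jc$. Fix vertices $x^-,x^+\in X_0$. A *d-path* $p:I\to|X|$ from $x^-$ to $x^+$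 is a path with a presentation: a finite subdivision $0=t_0\le\dots\le t_l=1$, cubes $e_k$ and continuous, coordinatewise non-decreasing $\beta_k:[t_{k-1},t_k]\to I^{\dim e_k}$ with $p(t)=[e_k;\beta_k(t)]$. It is *strict* if one can choose a presentation such that each coordinate of each $\beta_k$ is injective except that it may rest at $0$ and at $1$; it is *tame* if one can choose a presentation such that all $p(t_k)$ are vertices. Let $\vec S$ and $\vec{ST}$ be the sets of strict, respectively strict and tame, d-paths from $x^-$ to $x^+$. A *cube chain* $\mathbf c=(c_1,\dots,c_n)$ from $x^-$ to $x^+$ is a sequence of cubes of positive dimension such that the bottom vertex of $c_1$ is $x^-$, the top vertex of each cube is the bottom vertex of the next one, and the top vertex of $c_n$ is $x^+$ (if $x^-=x^+$, the empty chain is included). An elementary refinement of $\mathbf c$ replaces one cube $c_i$, $m=\dim c_i$, by the two cubes $d_{[J|\{1,\dots,m\}\setminus J|\emptyset]}c_i$, $d_{[\emptyset|J|\{1,\dots,m\}\setminus J]}c_i$, where $\emptyset\ne J\subsetneq\{1,\dots,m\}$; refinement is the reflexive and transitive closure. A common refinement of $\mathbf c$ and $\mathbf c'$ is *coarsest* if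 every common refinement of $\mathbf c$ and $\mathbf c'$ refines it. **Collar path spaces.** Let $\vec P^C_{\mathbf c}$ be the set of d-paths $p$ from $x^-$ to $x^+$ for which there is a subdivision $0=s_0\le s_1\le\dots\le s_n=1$ such that on $[s_{i-1},s_i]$ the path $p$ runs in the collar of $c_i$ from the star of the bottom vertex of $c_i$ to the star of its top vertex (for the empty chain: $p$ runs in the star of $x^-$), in the following sense. For $z\in I^m$ let $\nu(z)$ be the smallest face of $I^m$ whose collar contains $z$. There are a presentation $(e_k,\beta_k)$ of $p$ on $[s_{i-1},s_i]$ and a function $F$ from $[s_{i-1},s_i]$ to the faces of $I^{\dim c_i}$, with $F(s_{i-1})$ and $F(s_i)$ the bottom and the top vertex, such that in each interval of the presentation, near each time, there are faces $J$ of $I^{\dim e_k}$ and $K$ of $I^{\dim c_i}$ with $d_Je_k=d_Kc_i$ for which $\beta_k(t)\in C_J$ and $F(t)$ is the subface of $K$ corresponding to the subface $\nu(\beta_k(t))$ of $J$ under the order-preserving identification of free coordinates. Put $\vec S^C_{\mathbf c}=\vec S\cap\vec P^C_{\mathbf c}$ and $\vec{ST}^C_{\mathbf c}=\vec{ST}\cap\vec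 P^C_{\mathbf c}$. For $p\in\vec S$, each point $p(t)=[c;z]$ determines the cube $\rho(p(t))=d_{\nu(z)}c$; let $c(p)$ be the sequence of the cubes $\rho(p(t))$, in the order of time, at the finitely many times $t$ at which $\rho(p(t))$ is not a vertex (i.e. $p$ meets a middle hyperplane $z_j=\frac12$). **Proposition.** Let $X$ be a $\Box$-set with vertices $x^-,x^+$. For all cube chains $\mathbf c,\mathbf c',\mathbf c''$ from $x^-$ to $x^+$: 1. $\mathbf c'$ refines $\mathbf c$ if and only if $\vec S^C_{\mathbf c'}\subseteq\vec S^C_{\mathbf c}$. 2. If $\mathbf c'$ refines $\mathbf c$ and $\mathbf c'\ne\mathbf c$, then $\vec S^C_{\mathbf c'}$ is a proper subset of $\vec S^C_{\mathbf c}$. 3. For every $p\in\vec S$, $c(p)$ is a cube chain from $x^-$ to $x^+$, $p\in\vec S^C_{c(p)}$, and $c(p)$ refines every cube chain $\mathbf c$ with $p\in\vec S^C_{\mathbf c}$. 4. $\vec S^C_{\mathbf c}\cap\vec S^C_{\mathbf c'}\ne\emptyset$ if and only if $\mathbf c$ and $\mathbf c'$ have a common refinement. 5. If $\mathbf c''$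 is a common refinement of $\mathbf c$ and $\mathbf c'$, then $\vec S^C_{\mathbf c''}\subseteq\vec S^C_{\mathbf c}\cap\vec S^C_{\mathbf c'}$. If $\mathbf c''$ is a coarsest common refinement, equality holds. 6. If $X$ is proper and non-self-linked, then $\mathbf c$ and $\mathbf c'$ either have no common refinement or have a coarsest common refinement $\mathbf c''$, and then $\vec S^C_{\mathbf c''}=\vec S^C_{\mathbf c}\cap\vec S^C_{\mathbf c'}$. 7. Assertions 1 to 6 also hold with $\vec S$ replaced by $\vec{ST}$ throughout. Moreover, if $X$ is non-self-linked, then $\vec P^C_{\mathbf c}$ is the set of d-paths $p$ from $x^-$ to $x^+$ for which there is a subdivision $0=s_0\le\dots\le s_n=1$ with $p([s_{i-1},s_i])\subseteq C(c_i,X)$, $p(s_{i-1})\in st(\text{bottom vertex of }c_i)$ and $p(s_i)\in st(\text{top vertex of }c_i)$ for all $i$ (for the empty chain: $p(I)\subseteq st(x^-)$). -/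

import Mathlib

open Set Filter Topology
open scoped unitInterval

universe u

/-- A `□`-set (pre-cubical set): `face α i` is the face map `d_i^α`, with `i` counted from `0`,
`α = false` standing for `0` and `α = true` for `1`. -/
structure PrecubicalSet where
  cube : ℕ → Type u
  face : ∀ {n : ℕ}, Bool → Fin (n + 1) → cube (n + 1) → cube n
  face_face : ∀ {n : ℕ} (α β : Bool) (i j : Fin (n + 1)), i ≤ j → ∀ c : cube (n + 2),
    face α i (face β j.succ c) = face β j (face α i.castSucc c)

/-- A face of the cube `I^n`, i.e. a partition `[1:n] = J₀ ⊔ J_* ⊔ J₁`: the value `some false`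
marks `J₀`, the value `some true` marks `J₁`, and `none` marks the free coordinates `J_*`. -/
abbrev CubeFace (n : ℕ) : Type := Fin n → Option Bool

namespace CubeFace

/-- The vertex of `I^n` all of whose coordinates are `α`. -/
def corner (n : ℕ) (α : Bool) : CubeFace n := fun _ => some α

/-- The open collar `C_{[J₀|J_*|J₁]} I^n = [0,1/2[^{J₀} × I^{J_*} × ]1/2,1]^{J₁}`. -/
def collar {n : ℕ} (J : CubeFace n) : Set (Fin n → I) :=
  {x | ∀ i, (J i = some false → (x i : ℝ) < 1 / 2) ∧ (J i = some true → 1 / 2 < (x i : ℝ))}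

open Classical in
/-- The smallest face of `I^n` whose collar contains `x`: coordinates below `1/2` belong to `J₀`,
those above `1/2` to `J₁`, those equal to `1/2` are free. -/
noncomputable def nearest {n : ℕ} (x : Fin n → I) : CubeFace n := fun i =>
  if (x i : ℝ) < 1 / 2 then some false else if 1 / 2 < (x i : ℝ) then some true else none

/-- If the faces `J` of `I^m` and `K` of `I^n` have the same dimension, they are identified through
the order preserving bijection `φ` of their free coordinates; `transfer` is the resulting map from
subfaces of `J` to subfaces of `K`. -/
def transfer {m n : ℕ} (J : CubeFace m) (K : CubeFace n)
    (φ : {j : Fin m // J j = none} ≃o {i : Fin n // K i = none}) (G : CubeFace m) : CubeFace n :=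
  fun i => if h : K i = none then G (φ.symm ⟨i, h⟩) else K i

end CubeFace

namespace PrecubicalSet

/-- The cubes of `X` of all dimensions. -/
abbrev Cell (X : PrecubicalSet.{u}) : Type u := Σ n : ℕ, X.cube n

/-- The `□`-set whose `n`-cubes are the `(n+1)`-cubes of `X`, forgetting the two face maps in the
first direction. -/
abbrev shift (X : PrecubicalSet.{u}) : PrecubicalSet.{u} where
  cube n := X.cube (n + 1)
  face α i c := X.face α i.succ c
  face_face α β i j h c := by
    simpa using X.face_face α β i.succ j.succ (Fin.succ_le_succ_iff.mpr h) c

/-- The iterated face `d_{[J₀|J_*|J₁]} c`. Coordinates are processed from the first one on: a fixed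
coordinate is removed by the corresponding face map, a free one is kept. -/
def iterFace : (X : PrecubicalSet.{u}) → {n : ℕ} → CubeFace n → X.cube n → X.Cell
  | _, 0, _, c => ⟨0, c⟩
  | X, n + 1, J, c =>
    match J 0 with
    | some α => iterFace X (fun i : Fin n => J i.succ) (X.face α 0 c)
    | none =>
      let r := iterFace X.shift (n := n) (fun i : Fin n => J i.succ) c
      ⟨r.1 + 1, r.2⟩

/-- The source vertex (`α = false`) and the target vertex (`α = true`) of a cube. -/
def endVertex (X : PrecubicalSet.{u}) (α : Bool) : {n : ℕ} → X.cube n → X.cube 0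
  | 0, c => c
  | _ + 1, c => endVertex X α (X.face α 0 c)

/-- At most one cube with given source and target vertex. -/
def IsProper (X : PrecubicalSet.{u}) : Prop :=
  ∀ c d : X.Cell, X.endVertex false c.2 = X.endVertex false d.2 →
    X.endVertex true c.2 = X.endVertex true d.2 → c = d

/-- Different faces of `I^n` give different iterated faces of each `n`-cube. -/
def NonSelfLinked (X : PrecubicalSet.{u}) : Prop :=
  ∀ (n : ℕ) (c : X.cube n), Function.Injective fun J : CubeFace n => X.iterFace J c

/-! Geometric realization -/

/-- The gluing relation `[d_i^α c, x] ~ [c, δ_i^α x]` on the disjoint union of all cubes. -/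
inductive Glue (X : PrecubicalSet.{u}) :
    (Σ c : X.Cell, (Fin c.1 → I)) → (Σ c : X.Cell, (Fin c.1 → I)) → Prop
  | glue {n : ℕ} (c : X.cube (n + 1)) (i : Fin (n + 1)) (α : Bool) (x : Fin n → I) :
      Glue X ⟨⟨n, X.face α i c⟩, x⟩
        ⟨⟨n + 1, c⟩, i.insertNth (α := fun _ => I) (if α then 1 else 0) x⟩

/-- The geometric realization with the quotient topology. -/
def Realization (X : PrecubicalSet.{u}) : Type u := Quot X.Glue

instance (X : PrecubicalSet.{u}) : TopologicalSpace X.Realization :=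
  inferInstanceAs (TopologicalSpace (Quot X.Glue))

/-- The point `[c; x]`. -/
def pt (X : PrecubicalSet.{u}) {n : ℕ} (c : X.cube n) (x : Fin n → I) : X.Realization :=
  Quot.mk _ ⟨⟨n, c⟩, x⟩

/-- A vertex as a point of the realization. -/
def vertexPt (X : PrecubicalSet.{u}) (v : X.cube 0) : X.Realization := X.pt v Fin.elim0

theorem iterFace_fixed (X : PrecubicalSet.{u}) {n : ℕ} (J : CubeFace (n + 1)) (c : X.cube (n + 1))
    (α : Bool) (h : J 0 = some α) :
    X.iterFace J c = X.iterFace (fun i : Fin n => J i.succ) (X.face α 0 c) := by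
  rw [iterFace, h]

theorem iterFace_free (X : PrecubicalSet.{u}) {n : ℕ} (J : CubeFace (n + 1)) (c : X.cube (n + 1))
    (h : J 0 = none) :
    X.iterFace J c = ⟨(X.shift.iterFace (n := n) (fun i : Fin n => J i.succ) c).1 + 1,
      (X.shift.iterFace (n := n) (fun i : Fin n => J i.succ) c).2⟩ := by
  rw [iterFace, h]

/-- Fixed coordinates may be removed in any order. -/
theorem iterFace_remove : ∀ (X : PrecubicalSet.{u}) {n : ℕ} (J : CubeFace (n + 1))
    (c : X.cube (n + 1)) (i : Fin (n + 1)) (α : Bool), J i = some α →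
    X.iterFace J c = X.iterFace (fun k => J (i.succAbove k)) (X.face α i c) := by
  intro X n
  induction n generalizing X with
  | zero =>
    intro J c i α h
    obtain rfl : i = 0 := Fin.fin_one_eq_zero i
    exact X.iterFace_fixed J c α h
  | succ n ih =>
    intro J c i α h
    revert h
    refine Fin.cases (fun h => ?_) (fun j h => ?_) i
    · simpa using X.iterFace_fixed J c α h
    · have h0 : (j.succ).succAbove (0 : Fin (n + 1)) = 0 := by simp
      have hs : (fun k : Fin n => J (j.succ.succAbove k.succ))
          = fun k => J (j.succAbove k).succ := by
        funext k; rw [Fin.succ_succAbove_succ]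
      cases hJ : J 0 with
      | some β =>
        rw [X.iterFace_fixed J c β hJ, X.iterFace_fixed _ (X.face α j.succ c) β (by rw [h0, hJ]),
          ih X _ (X.face β 0 c) j α h, X.face_face β α 0 j (Fin.zero_le _) c, hs,
          Fin.castSucc_zero]
      | none =>
        rw [X.iterFace_free J c hJ, X.iterFace_free _ (X.face α j.succ c) (by rw [h0, hJ]),
          ih X.shift _ c j α h, hs]

/-- The smallest cube of `X` whose collar contains a given point of the realization. -/
noncomputable def nearestFace (X : PrecubicalSet.{u}) : X.Realization → X.Cell :=
  Quot.lift (fun y => X.iterFace (CubeFace.nearest y.2) y.1.2) (by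
    rintro _ _ ⟨c, i, α, x⟩
    have h : CubeFace.nearest (i.insertNth (α := fun _ => I) (if α then 1 else 0) x) i
        = some α := by
      cases α <;> norm_num [CubeFace.nearest]
    refine Eq.symm ((X.iterFace_remove _ c i α h).trans ?_)
    congr 1
    funext k
    simp [CubeFace.nearest])

/-- The collar `C(d, X)`: the union of the sets `C_J c` over all cubes `c` and all faces `J` such
that `d_J c` is an iterated face of `d` (or `d` itself). For a vertex `d` it is the star of `d`. -/
def collar (X : PrecubicalSet.{u}) (d : X.Cell) : Set X.Realization :=
  {y | ∃ (n : ℕ) (c : X.cube n) (J : CubeFace n) (x : Fin n → I),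
    y = X.pt c x ∧ x ∈ CubeFace.collar J ∧ ∃ K : CubeFace d.1, X.iterFace J c = X.iterFace K d.2}

/-- The star of a vertex. -/
def star (X : PrecubicalSet.{u}) (v : X.cube 0) : Set X.Realization := X.collar ⟨0, v⟩

/-! Directed paths -/

/-- A presentation `[c₁;β₁] *_{t₁} [c₂;β₂] * ⋯ * [c_l;β_l]` of `p` on the interval `[a, b]`, with
increasing paths `β_k` in cubes. -/
structure Presentation (X : PrecubicalSet.{u}) (p : I → X.Realization) (a b : I) where
  len : ℕ
  time : Fin (len + 1) → I
  time_mono : Monotone time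
  time_zero : time 0 = a
  time_last : time (Fin.last len) = b
  dim : Fin len → ℕ
  cube : ∀ k, X.cube (dim k)
  path : ∀ k, I → (Fin (dim k) → I)
  path_cont : ∀ k, ContinuousOn (path k) (Icc (time k.castSucc) (time k.succ))
  path_mono : ∀ k, MonotoneOn (path k) (Icc (time k.castSucc) (time k.succ))
  eq_pt : ∀ k, ∀ t ∈ Icc (time k.castSucc) (time k.succ), p t = X.pt (cube k) (path k t)

/-- All the paths `β_k` are strictly increasing: a coordinate may rest only at `0` or `1`. -/
def Presentation.IsStrict {X : PrecubicalSet.{u}} {p : I → X.Realization} {a b : I}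
    (P : X.Presentation p a b) : Prop :=
  ∀ (k : Fin P.len) (i : Fin (P.dim k)),
    ∀ s ∈ Icc (P.time k.castSucc) (P.time k.succ), ∀ t ∈ Icc (P.time k.castSucc) (P.time k.succ),
      P.path k s i = P.path k t i → s = t ∨ P.path k s i = 0 ∨ P.path k s i = 1

/-- All the subdivision points are mapped to vertices. -/
def Presentation.IsTame {X : PrecubicalSet.{u}} {p : I → X.Realization} {a b : I}
    (P : X.Presentation p a b) : Prop :=
  ∀ k, ∃ v : X.cube 0, p (P.time k) = X.vertexPt v

/-- The directed paths from the vertex `x` to the vertex `y`. -/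
def dPaths (X : PrecubicalSet.{u}) (x y : X.cube 0) : Set C(I, X.Realization) :=
  {p | p 0 = X.vertexPt x ∧ p 1 = X.vertexPt y ∧ Nonempty (X.Presentation p 0 1)}

/-- The strictly directed paths from `x` to `y`. -/
def strictPaths (X : PrecubicalSet.{u}) (x y : X.cube 0) : Set C(I, X.Realization) :=
  {p | p ∈ X.dPaths x y ∧ ∃ P : X.Presentation p 0 1, P.IsStrict}

/-- The tame directed paths from `x` to `y`. -/
def tamePaths (X : PrecubicalSet.{u}) (x y : X.cube 0) : Set C(I, X.Realization) :=
  {p | p ∈ X.dPaths x y ∧ ∃ P : X.Presentation p 0 1, P.IsTame}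

/-- The strictly directed and tame paths from `x` to `y`. -/
def strictTamePaths (X : PrecubicalSet.{u}) (x y : X.cube 0) : Set C(I, X.Realization) :=
  X.strictPaths x y ∩ X.tamePaths x y

/-! Cube chains and refinement -/

/-- The cubes of the list are consecutive and lead from `x` to `y`. -/
def Linked (X : PrecubicalSet.{u}) : X.cube 0 → List X.Cell → X.cube 0 → Prop
  | x, [], y => x = y
  | x, c :: cs, y => X.endVertex false c.2 = x ∧ X.Linked (X.endVertex true c.2) cs y

/-- Cube chains from `x` to `y`. If `x = y` there is the empty chain. -/
@[ext] structure CubeChain (X : PrecubicalSet.{u}) (x y : X.cube 0) where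
  cubes : List X.Cell
  dim_pos : ∀ c ∈ cubes, 0 < c.1
  linked : X.Linked x cubes y

open Classical in
/-- The face `d_{[J|[1:n]∖J|∅]} e`. -/
noncomputable def splitFirst (X : PrecubicalSet.{u}) {n : ℕ} (J : Set (Fin n)) (e : X.cube n) :
    X.Cell :=
  X.iterFace (fun i => if i ∈ J then some false else none) e

open Classical in
/-- The face `d_{[∅|J|[1:n]∖J]} e`. -/
noncomputable def splitSecond (X : PrecubicalSet.{u}) {n : ℕ} (J : Set (Fin n)) (e : X.cube n) :
    X.Cell :=
  X.iterFace (fun i => if i ∈ J then none else some true) e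

namespace CubeChain

variable {X : PrecubicalSet.{u}} {x y : X.cube 0}

/-- `c'` arises from `c` by replacing one cube by one of its elementary refinements. -/
def ElementaryRefines (c' c : X.CubeChain x y) : Prop :=
  ∃ (L R : List X.Cell) (n : ℕ) (e : X.cube n) (J : Set (Fin n)),
    J ≠ ∅ ∧ J ≠ univ ∧ c.cubes = L ++ ⟨n, e⟩ :: R ∧
      c'.cubes = L ++ X.splitFirst J e :: X.splitSecond J e :: R

/-- `c'` refines `c`: reflexive and transitive closure of elementary refinement. -/
def Refines (c' c : X.CubeChain x y) : Prop :=
  Relation.ReflTransGen (fun d d' : X.CubeChain x y => d'.ElementaryRefines d) c c'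

/-- `d` is a common refinement of `c` and `c'`. -/
def IsCommonRefinement (d c c' : X.CubeChain x y) : Prop := d.Refines c ∧ d.Refines c'

/-- `d` is a coarsest common refinement of `c` and `c'`. -/
def IsCoarsestCommonRefinement (d c c' : X.CubeChain x y) : Prop :=
  d.IsCommonRefinement c c' ∧ ∀ e : X.CubeChain x y, e.IsCommonRefinement c c' → e.Refines d

/-- The cubes of a chain; the empty chain from `x` to `x` is represented by the `0`-cube `x`. -/
def pieces (c : X.CubeChain x y) : List X.Cell :=
  match c.cubes with
  | [] => [⟨0, x⟩]
  | e :: es => e :: es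

end CubeChain

/-! Paths subordinate to the collar of a cube chain -/

/-- On the interval `[a, b]`, the path `p` is a directed path in the collar of the cube `e`, from the
star of the source vertex of `e` to the star of its target vertex.

In a self-linked `□`-set different faces of `I^n` may give the same iterated face of `e`, so it has
to be recorded which face of `I^n` the path is close to: `F t` is this face at time `t`. Near every
time, `p` runs in the collar `C_J c_k` of an iterated face `d_J c_k = d_K e`, and `F` is given by the
smallest subface of `J` whose collar contains the path `β_k`. -/
def RunsInCollar (X : PrecubicalSet.{u}) (p : I → X.Realization) (e : X.Cell) (a b : I) : Prop :=
  ∃ (P : X.Presentation p a b) (F : I → CubeFace e.1),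
    F a = CubeFace.corner e.1 false ∧ F b = CubeFace.corner e.1 true ∧
    ∀ (k : Fin P.len), ∀ s ∈ Icc (P.time k.castSucc) (P.time k.succ),
      ∃ (J : CubeFace (P.dim k)) (K : CubeFace e.1)
        (φ : {j : Fin (P.dim k) // J j = none} ≃o {i : Fin e.1 // K i = none}),
        X.iterFace J (P.cube k) = X.iterFace K e.2 ∧
        ∀ᶠ t in 𝓝[Icc (P.time k.castSucc) (P.time k.succ)] s,
          P.path k t ∈ CubeFace.collar J ∧
            F t = CubeFace.transfer J K φ (CubeFace.nearest (P.path k t))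

/-- On `[a, b]`, the path `p` takes its values in the subset `C(e, X)` of the realization, starts in
the star of the source vertex of `e` and ends in the star of its target vertex. -/
def StaysInCollar (X : PrecubicalSet.{u}) (p : I → X.Realization) (e : X.Cell) (a b : I) : Prop :=
  (∀ t ∈ Icc a b, p t ∈ X.collar e) ∧ p a ∈ X.star (X.endVertex false e.2) ∧
    p b ∈ X.star (X.endVertex true e.2)

/-- `[a, b]` has a subdivision into intervals, one for each cube of the list, on which `Q` holds. -/
def Concatenates {X : PrecubicalSet.{u}} (Q : X.Cell → I → I → Prop) : List X.Cell → I → I → Prop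
  | [], a, b => a = b
  | e :: es, a, b => ∃ t, a ≤ t ∧ t ≤ b ∧ Q e a t ∧ Concatenates Q es t b

/-- The directed paths from `x` to `y` subordinate to the collar of the chain `c`. -/
def collarPaths (X : PrecubicalSet.{u}) {x y : X.cube 0} (c : X.CubeChain x y) :
    Set C(I, X.Realization) :=
  {p | p ∈ X.dPaths x y ∧ Concatenates (X.RunsInCollar p) c.pieces 0 1}

/-- The directed paths from `x` to `y` that are concatenations of paths in the subsets `C(c_i, X)`
of the realization, with subdivision points in the stars of the vertices of the chain `c`. -/
def plainCollarPaths (X : PrecubicalSet.{u}) {x y : X.cube 0} (c : X.CubeChain x y) :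
    Set C(I, X.Realization) :=
  {p | p ∈ X.dPaths x y ∧ Concatenates (X.StaysInCollar p) c.pieces 0 1}

/-- The times at which `p` meets a middle hyperplane `x_i = 1/2` of some cube. -/
def crossingTimes (X : PrecubicalSet.{u}) (p : I → X.Realization) : Set I :=
  {t | 0 < (X.nearestFace (p t)).1}

open Classical in
/-- The cubes of the chain `c(p)`: at each of the finitely many times at which the strict path `p`
meets a middle hyperplane, take the smallest cube whose collar contains the point of `p`. -/
noncomputable def crossingCubes (X : PrecubicalSet.{u}) (p : I → X.Realization) : List X.Cell :=
  if h : (X.crossingTimes p).Finite then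
    (h.toFinset.sort (· ≤ ·)).map fun t => X.nearestFace (p t)
  else []

end PrecubicalSet

/-!
For a strict d-path `p`, the trace `t ↦ ρ(p(t))` is a step function: a coordinate in `]0, 1[` is
strictly increasing, so immediately before a time the trace takes the source vertex of its value at
that time, and immediately afterwards the target vertex. The cubes crossed by the trace therefore
form a cube chain `c(p)`.

The function `F` in the definition of the collar path spaces is exactly a lift of the trace through
`J ↦ d_J e` to a step function with values in the faces of `I^n`. Such a lift from the bottom to the
top vertex exists if and only if the crossed cubes are the image of a chain of faces of `I^n`, that
is, if and only if they refine `e`. Hence a strict path lies in the collar path space of `c` if and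
only if `c(p)` refines `c`. Conversely, running along the diagonals of the cubes of a chain gives a
strict and tame path with this chain as `c(p)`, and all assertions become assertions on the
refinement order.

In a proper □-set, a coarsest common refinement is built by comparing the first cubes of the two
chains: the one of smaller dimension is split off the other, and what remains of the latter is
determined by its end vertices.
-/

/-- A type of cells, each of which has a source and a target vertex. Vertices are not a separate
type: they are the cells which are their own source, and then also their own target. -/
class HasEnds (C : Type*) where
  src : C → C
  tgt : C → C
  src_src : ∀ c, src (src c) = src c
  src_tgt : ∀ c, src (tgt c) = tgt c
  tgt_of_src : ∀ c, src c = c → tgt c = c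

namespace HasEnds

variable {C D : Type*} [HasEnds C] [HasEnds D]

/-- The vertices among the cells. -/
def IsVertex (c : C) : Prop := src c = c

theorem isVertex_src (c : C) : IsVertex (src c) := src_src c

theorem isVertex_tgt (c : C) : IsVertex (tgt c) := src_tgt c

theorem IsVertex.tgt_eq {c : C} (h : IsVertex c) : tgt c = c := tgt_of_src c h

/-- Maps of cells compatible with sources and targets. They may collapse cells to vertices. -/
structure PreservesEnds (f : C → D) : Prop where
  map_src : ∀ c, f (src c) = src (f c)
  map_tgt : ∀ c, f (tgt c) = tgt (f c)

/-- `Chain u l v` says that the cells of `l` are no vertices, are consecutive and lead from the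
vertex `u` to the vertex `v`. -/
def Chain : C → List C → C → Prop
  | u, [], v => u = v
  | u, c :: cs, v => ¬IsVertex c ∧ src c = u ∧ Chain (tgt c) cs v

namespace Chain

variable {u u' v v' : C} {l l' : List C}

theorem nil_iff : Chain u [] v ↔ u = v := Iff.rfl

theorem cons_iff {c : C} : Chain u (c :: l) v ↔ ¬IsVertex c ∧ src c = u ∧ Chain (tgt c) l v :=
  Iff.rfl

theorem append_iff : Chain u (l ++ l') v ↔ ∃ m, Chain u l m ∧ Chain m l' v := by
  induction l generalizing u with
  | nil => simp [nil_iff]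
  | cons c cs ih => simp only [List.cons_append, cons_iff, ih]; grind

theorem map (h : Chain u l v) {f : C → D} (hf : PreservesEnds f)
    (hl : ∀ c ∈ l, IsVertex (f c) → IsVertex c) : Chain (f u) (l.map f) (f v) := by
  induction l generalizing u with
  | nil => exact congrArg f h
  | cons c cs ih =>
    obtain ⟨hc, rfl, hcs⟩ := h
    refine ⟨fun hfc => hc (hl c List.mem_cons_self hfc), (hf.map_src c).symm, ?_⟩
    rw [← hf.map_tgt c]
    exact ih hcs fun d hd => hl d (List.mem_cons_of_mem c hd)

theorem not_isVertex (h : Chain u l v) {c : C} (hc : c ∈ l) : ¬IsVertex c := by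
  induction l generalizing u with
  | nil => simp at hc
  | cons d cs ih =>
    rcases List.mem_cons.mp hc with rfl | hc
    · exact h.1
    · exact ih h.2.2 hc

theorem isVertex_right (h : Chain u l v) (hu : IsVertex u) : IsVertex v := by
  induction l generalizing u with
  | nil => exact nil_iff.mp h ▸ hu
  | cons c cs ih => exact ih h.2.2 (isVertex_tgt c)

theorem unique_right (h : Chain u l v) (h' : Chain u l v') : v = v' := by
  induction l generalizing u with
  | nil => exact (nil_iff.mp h).symm.trans h'
  | cons c cs ih => exact ih h.2.2 h'.2.2

theorem unique_left (h : Chain u l v) (h' : Chain u' l v') (hl : l ≠ []) : u = u' := by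
  cases l with
  | nil => exact absurd rfl hl
  | cons c cs => exact h.2.1.symm.trans h'.2.1

end Chain

end HasEnds

open HasEnds

namespace CubeFace

variable {m n : ℕ}

instance : HasEnds (CubeFace n) where
  src G i := some ((G i).getD false)
  tgt G i := some ((G i).getD true)
  src_src _ := rfl
  src_tgt _ := rfl
  tgt_of_src G h := by
    funext i
    have := congrFun h i
    cases hG : G i <;> simp_all

theorem src_apply (G : CubeFace n) (i : Fin n) : src G i = some ((G i).getD false) := rfl

theorem tgt_apply (G : CubeFace n) (i : Fin n) : tgt G i = some ((G i).getD true) := rfl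

theorem isVertex_iff {G : CubeFace n} : IsVertex G ↔ ∀ i, G i ≠ none := by
  refine ⟨fun h i hi => ?_, fun h => funext fun i => ?_⟩
  · have := congrFun h i
    simp [src_apply, hi] at this
  · rw [src_apply]
    cases hG : G i with
    | none => exact absurd hG (h i)
    | some α => rfl

/-- `G` is a face of the face `J`: every coordinate fixed in `J` is fixed in `G` at the same
value. -/
def IsSubface (G J : CubeFace n) : Prop := ∀ i α, J i = some α → G i = some α

theorem IsSubface.refl (J : CubeFace n) : J.IsSubface J := fun _ _ h => h

theorem src_isSubface (J : CubeFace n) : IsSubface (src J) J := fun i α h => by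
  rw [src_apply, h]; rfl

theorem tgt_isSubface (J : CubeFace n) : IsSubface (tgt J) J := fun i α h => by
  rw [tgt_apply, h]; rfl

section Transfer

variable {J : CubeFace m} {K : CubeFace n}
  (φ : {j : Fin m // J j = none} ≃o {i : Fin n // K i = none})

theorem preservesEnds_transfer : PreservesEnds (transfer J K φ) where
  map_src G := by
    funext i
    rw [src_apply]
    unfold transfer
    split_ifs with h
    · rfl
    · obtain ⟨α, hα⟩ := Option.ne_none_iff_exists'.mp h
      rw [hα, Option.getD_some]
  map_tgt G := by
    funext i
    rw [tgt_apply]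
    unfold transfer
    split_ifs with h
    · rfl
    · obtain ⟨α, hα⟩ := Option.ne_none_iff_exists'.mp h
      rw [hα, Option.getD_some]

theorem transfer_self : transfer J K φ J = K := by
  funext i
  unfold transfer
  split_ifs with h
  · rw [(φ.symm ⟨i, h⟩).2, h]
  · rfl

theorem transfer_isSubface (G : CubeFace m) : IsSubface (transfer J K φ G) K := fun i α hi => by
  simp [transfer, hi]

end Transfer

end CubeFace

namespace PrecubicalSet

variable {X : PrecubicalSet.{u}} {m n : ℕ}

instance : HasEnds X.Cell where
  src c := ⟨0, X.endVertex false c.2⟩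
  tgt c := ⟨0, X.endVertex true c.2⟩
  src_src _ := rfl
  src_tgt _ := rfl
  tgt_of_src := by
    rintro ⟨n, c⟩ h
    obtain rfl : 0 = n := congrArg Sigma.fst h
    rfl

theorem isVertex_iff {c : X.Cell} : IsVertex c ↔ c.1 = 0 := by
  refine ⟨fun h => (congrArg Sigma.fst h).symm, fun h => ?_⟩
  obtain ⟨n, c⟩ := c
  subst h
  rfl

theorem not_isVertex_iff {c : X.Cell} : ¬IsVertex c ↔ 0 < c.1 := by
  rw [isVertex_iff, Nat.pos_iff_ne_zero]

theorem iterFace_fst (J : CubeFace n) (c : X.cube n) :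
    (X.iterFace J c).1 = Fintype.card {j : Fin n // J j = none} := by
  induction n generalizing X with
  | zero => simp [iterFace]
  | succ n ih =>
    have hcard : Fintype.card {j : Fin (n + 1) // J j = none}
        = (if J 0 = none then 1 else 0) + Fintype.card {j : Fin n // J j.succ = none} := by
      simp only [Fintype.card_subtype, Finset.card_filter, Fin.sum_univ_succ]
    cases hJ : J 0 with
    | some α => rw [X.iterFace_fixed J _ α hJ, ih, hcard]; simp [hJ]
    | none => rw [X.iterFace_free J _ hJ, hcard]; simp [hJ, ih, add_comm]

theorem iterFace_none (c : X.cube n) : X.iterFace (fun _ => none) c = ⟨n, c⟩ := by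
  induction n generalizing X with
  | zero => rfl
  | succ n ih => rw [X.iterFace_free _ _ rfl, ih]

theorem iterFace_corner (α : Bool) (c : X.cube n) :
    X.iterFace (CubeFace.corner n α) c = ⟨0, X.endVertex α c⟩ := by
  induction n with
  | zero => rfl
  | succ n ih =>
    rw [X.iterFace_fixed _ _ α rfl]
    exact ih _

theorem iterFace_eq_iterFace_comp_of_strictMono {J G : CubeFace n} (hG : G.IsSubface J)
    {c : X.cube n} {d : X.Cell} (hd : X.iterFace J c = d) {ψ : Fin d.1 → Fin n}
    (hψ : StrictMono ψ) (hrange : range ψ = {j | J j = none}) :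
    X.iterFace G c = X.iterFace (G ∘ ψ) d.2 := by
  induction n with
  | zero => subst hd; rfl
  | succ n ih =>
    by_cases hJ : ∃ i α, J i = some α
    · obtain ⟨i, α, hi⟩ := hJ
      have hne : ∀ k, ψ k ≠ i := fun k hk => by
        have : J (ψ k) = none := hrange.subset (mem_range_self k)
        simp [hk, hi] at this
      choose ψ' hψ' using fun k => Fin.exists_succAbove_eq (hne k)
      have hmono : StrictMono ψ' := fun a b hab => by
        simpa [hψ'] using (Fin.strictMono_succAbove i).lt_iff_lt.mp (by simpa [hψ'] using hψ hab)
      have hrange' : range ψ' = {j | J (i.succAbove j) = none} := by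
        ext j
        refine ⟨?_, fun hj => ?_⟩
        · rintro ⟨k, rfl⟩
          exact hrange.subset ⟨k, (hψ' k).symm⟩
        · obtain ⟨k, hk⟩ := hrange.symm.subset hj
          exact ⟨k, Fin.succAbove_right_injective ((hψ' k).trans hk)⟩
      rw [X.iterFace_remove J c i α hi] at hd
      rw [X.iterFace_remove G c i α (hG i α hi),
        ih (fun k => hG (i.succAbove k)) hd hmono hrange']
      congr 1
      exact funext fun k => congrArg G (hψ' k)
    · obtain rfl : J = fun _ => none := funext fun i =>
        Option.eq_none_iff_forall_ne_some.mpr fun α hα => hJ ⟨i, α, hα⟩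
      rw [iterFace_none] at hd
      subst hd
      have hid : ψ = id := (hψ.range_inj strictMono_id).mp (by simpa using hrange)
      rw [hid, Function.comp_id]

theorem iterFace_eq_iterFace_comp {J G : CubeFace n} (hG : G.IsSubface J) {c : X.cube n}
    {d : X.Cell} (hd : X.iterFace J c = d) (ψ : Fin d.1 ≃o {j : Fin n // J j = none}) :
    X.iterFace G c = X.iterFace (fun k => G (ψ k)) d.2 :=
  iterFace_eq_iterFace_comp_of_strictMono hG hd (ψ := fun k => ψ k)
    (fun _ _ h => ψ.strictMono h)
    ((ψ.surjective.range_comp Subtype.val).trans Subtype.range_coe)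

theorem exists_orderIso_free {J : CubeFace n} {c : X.cube n} {d : X.Cell}
    (hd : X.iterFace J c = d) : Nonempty (Fin d.1 ≃o {j : Fin n // J j = none}) :=
  ⟨Fintype.orderIsoFinOfCardEq _ (hd ▸ (iterFace_fst J c).symm)⟩

theorem exists_orderIso_of_iterFace_eq {J : CubeFace m} {K : CubeFace n} {c : X.cube m}
    {e : X.cube n} (h : X.iterFace J c = X.iterFace K e) :
    Nonempty ({j : Fin m // J j = none} ≃o {i : Fin n // K i = none}) := by
  obtain ⟨ψ⟩ := exists_orderIso_free h
  obtain ⟨ψ'⟩ := exists_orderIso_free (rfl : X.iterFace K e = _)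
  exact ⟨ψ.symm.trans ψ'⟩

theorem preservesEnds_iterFace (c : X.cube n) :
    PreservesEnds fun J : CubeFace n => X.iterFace J c where
  map_src J := by
    obtain ⟨ψ⟩ := exists_orderIso_free (rfl : X.iterFace J c = _)
    have hcorner : (fun k => src J (ψ k : Fin n)) = CubeFace.corner _ false :=
      funext fun k => by rw [CubeFace.src_apply, (ψ k).2]; rfl
    rw [iterFace_eq_iterFace_comp (CubeFace.src_isSubface J) rfl ψ, hcorner, iterFace_corner]
    rfl
  map_tgt J := by
    obtain ⟨ψ⟩ := exists_orderIso_free (rfl : X.iterFace J c = _)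
    have hcorner : (fun k => tgt J (ψ k : Fin n)) = CubeFace.corner _ true :=
      funext fun k => by rw [CubeFace.tgt_apply, (ψ k).2]; rfl
    rw [iterFace_eq_iterFace_comp (CubeFace.tgt_isSubface J) rfl ψ, hcorner, iterFace_corner]
    rfl

theorem isVertex_iterFace_iff {J : CubeFace n} {c : X.cube n} :
    IsVertex (X.iterFace J c) ↔ IsVertex J := by
  rw [isVertex_iff, iterFace_fst, Fintype.card_eq_zero_iff, CubeFace.isVertex_iff]
  exact ⟨fun h i hi => h.elim ⟨i, hi⟩, fun h => ⟨fun i => h i.1 i.2⟩⟩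

theorem iterFace_transfer {J : CubeFace m} {K : CubeFace n}
    (φ : {j : Fin m // J j = none} ≃o {i : Fin n // K i = none}) {c : X.cube m} {e : X.cube n}
    (h : X.iterFace J c = X.iterFace K e) {G : CubeFace m} (hG : G.IsSubface J) :
    X.iterFace (CubeFace.transfer J K φ G) e = X.iterFace G c := by
  obtain ⟨ψ⟩ := exists_orderIso_free h
  rw [iterFace_eq_iterFace_comp hG h ψ,
    iterFace_eq_iterFace_comp (CubeFace.transfer_isSubface φ G) rfl (ψ.trans φ)]
  congr 1
  funext k
  have : K (φ (ψ k)) = none := (φ (ψ k)).2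
  simp [CubeFace.transfer, this]

end PrecubicalSet

namespace CubeFace

variable {n : ℕ}

theorem eq_some_true_of_chain {u v : CubeFace n} {L : List (CubeFace n)} (h : Chain u L v)
    {i : Fin n} (hi : u i = some true) : v i = some true ∧ ∀ G ∈ L, G i = some true := by
  induction L generalizing u with
  | nil => simpa [← Chain.nil_iff.mp h] using hi
  | cons G L ih =>
    obtain ⟨-, rfl, hL⟩ := h
    have hG : G i = some true := by
      rw [src_apply] at hi
      cases hG : G i <;> simp_all
    simpa [hG] using ih hL (by simp [tgt_apply, hG])

theorem eq_some_false_of_chain {u v : CubeFace n} {L : List (CubeFace n)} (h : Chain u L v)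
    {i : Fin n} (hi : v i = some false) : u i = some false ∧ ∀ G ∈ L, G i = some false := by
  induction L generalizing u with
  | nil => simpa [Chain.nil_iff.mp h] using hi
  | cons G L ih =>
    obtain ⟨-, rfl, hL⟩ := h
    obtain ⟨htgt, hmem⟩ := ih hL
    have hG : G i = some false := by
      rw [tgt_apply] at htgt
      cases hG : G i <;> simp_all
    simpa [src_apply, hG] using hmem

theorem isSubface_of_chain {K : CubeFace n} {L : List (CubeFace n)}
    (h : Chain (src K) L (tgt K)) {G : CubeFace n} (hG : G ∈ L) : G.IsSubface K := by
  rintro i (_ | _) hi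
  · exact (eq_some_false_of_chain h (i := i) (by simp [tgt_apply, hi])).2 G hG
  · exact (eq_some_true_of_chain h (i := i) (by simp [src_apply, hi])).2 G hG

theorem sum_card_free_add {u v : CubeFace n} {L : List (CubeFace n)} (h : Chain u L v) :
    (L.map fun G => Fintype.card {j : Fin n // G j = none}).sum
      + Fintype.card {j : Fin n // v j = some false}
      = Fintype.card {j : Fin n // u j = some false} := by
  induction L generalizing u with
  | nil => simp [Chain.nil_iff.mp h]
  | cons G L ih =>
    obtain ⟨-, rfl, hL⟩ := h
    rw [List.map_cons, List.sum_cons, add_assoc, ih hL]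
    simp only [Fintype.card_subtype, Finset.card_filter, ← Finset.sum_add_distrib]
    refine Finset.sum_congr rfl fun i _ => ?_
    rw [src_apply, tgt_apply]
    rcases G i with _ | _ | _ <;> simp

open Classical in
/-- The vertex `[J|∅|[1:n]∖J]` at which the elementary refinement of `I^n` given by `J` passes from
its first to its second cube. -/
noncomputable def splitVertex (J : Set (Fin n)) : CubeFace n := fun i =>
  if i ∈ J then some false else some true

open Classical in
/-- The face `[J|[1:n]∖J|∅]`, the first cube of the elementary refinement of `I^n` given by `J`. -/
noncomputable def splitFirst (J : Set (Fin n)) : CubeFace n := fun i =>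
  if i ∈ J then some false else none

open Classical in
/-- The face `[∅|J|[1:n]∖J]`, the second cube of the elementary refinement of `I^n` given by
`J`. -/
noncomputable def splitSecond (J : Set (Fin n)) : CubeFace n := fun i =>
  if i ∈ J then none else some true

theorem src_splitFirst (J : Set (Fin n)) : src (splitFirst J) = corner n false := by
  funext i
  by_cases hi : i ∈ J <;> simp [src_apply, splitFirst, corner, hi]

theorem tgt_splitFirst (J : Set (Fin n)) : tgt (splitFirst J) = splitVertex J := by
  funext i
  by_cases hi : i ∈ J <;> simp [tgt_apply, splitFirst, splitVertex, hi]

theorem src_splitSecond (J : Set (Fin n)) : src (splitSecond J) = splitVertex J := by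
  funext i
  by_cases hi : i ∈ J <;> simp [src_apply, splitSecond, splitVertex, hi]

theorem tgt_splitSecond (J : Set (Fin n)) : tgt (splitSecond J) = corner n true := by
  funext i
  by_cases hi : i ∈ J <;> simp [tgt_apply, splitSecond, corner, hi]

theorem isVertex_splitFirst_iff {J : Set (Fin n)} : IsVertex (splitFirst J) ↔ J = univ := by
  simp [isVertex_iff, splitFirst, eq_univ_iff_forall]

theorem isVertex_splitSecond_iff {J : Set (Fin n)} : IsVertex (splitSecond J) ↔ J = ∅ := by
  simp [isVertex_iff, splitSecond, eq_empty_iff_forall_notMem]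

theorem exists_eq_splitVertex {m : CubeFace n} (hm : IsVertex m) : ∃ J, m = splitVertex J := by
  refine ⟨{i | m i = some false}, funext fun i => ?_⟩
  have := isVertex_iff.mp hm i
  rcases h : m i with _ | _ | _ <;> simp_all [splitVertex]

end CubeFace

namespace PrecubicalSet

variable {X : PrecubicalSet.{u}} {m n : ℕ}

/-- The list `l` is a refinement of the cube `e`: it is the image of a chain of faces of `I^n` from
the bottom to the top vertex. A vertex is refined by the empty list only. -/
def RefinesCell (e : X.Cell) (l : List X.Cell) : Prop :=
  ∃ L : List (CubeFace e.1), Chain (CubeFace.corner e.1 false) L (CubeFace.corner e.1 true) ∧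
    L.map (fun G => X.iterFace G e.2) = l

theorem RefinesCell.chain {e : X.Cell} {l : List X.Cell} (h : RefinesCell e l) :
    Chain (src e) l (tgt e) := by
  obtain ⟨L, hL, rfl⟩ := h
  have := hL.map (preservesEnds_iterFace e.2) fun _ _ => isVertex_iterFace_iff.mp
  rwa [iterFace_corner, iterFace_corner] at this

theorem RefinesCell.dim_pos {e c : X.Cell} {l : List X.Cell} (h : RefinesCell e l) (hc : c ∈ l) :
    0 < c.1 :=
  not_isVertex_iff.mp (h.chain.not_isVertex hc)

theorem RefinesCell.sum_dim {e : X.Cell} {l : List X.Cell} (h : RefinesCell e l) :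
    (l.map Sigma.fst).sum = e.1 := by
  obtain ⟨L, hL, rfl⟩ := h
  simpa [Function.comp_def, iterFace_fst, CubeFace.corner] using CubeFace.sum_card_free_add hL

theorem refinesCell_self {e : X.Cell} (he : 0 < e.1) : RefinesCell e [e] := by
  refine ⟨[fun _ => none], ⟨?_, rfl, rfl⟩, ?_⟩
  · rw [CubeFace.isVertex_iff]
    exact fun h => h ⟨0, he⟩ rfl
  · simp [iterFace_none]

theorem refinesCell_nil_iff {e : X.Cell} : RefinesCell e [] ↔ e.1 = 0 := by
  refine ⟨fun h => by simpa using h.sum_dim.symm, fun h => ⟨[], funext fun i => ?_, rfl⟩⟩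
  rw [h] at i
  exact i.elim0

theorem refinesCell_iff_of_dim_eq_zero {e : X.Cell} (he : e.1 = 0) {l : List X.Cell} :
    RefinesCell e l ↔ l = [] := by
  refine ⟨fun h => ?_, fun h => h ▸ refinesCell_nil_iff.mpr he⟩
  by_contra hl
  obtain ⟨c, hc⟩ := List.exists_mem_of_ne_nil l hl
  have hle := List.single_le_sum (l := l.map Sigma.fst) (by simp) c.1 (List.mem_map_of_mem hc)
  have := h.dim_pos hc
  rw [h.sum_dim, he] at hle
  omega

theorem RefinesCell.eq_of_singleton {e f : X.Cell} (h : RefinesCell e [f]) : f = e := by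
  obtain ⟨L, hL, hl⟩ := h
  obtain ⟨G, rfl, rfl⟩ := List.map_eq_singleton_iff.mp hl
  have hG : G = fun _ => none := funext fun i => by
    have hsrc := congrFun hL.2.1 i
    have htgt := congrFun (Chain.nil_iff.mp hL.2.2) i
    rw [CubeFace.src_apply] at hsrc
    rw [CubeFace.tgt_apply] at htgt
    rcases hG : G i with _ | _ | _ <;> simp_all [CubeFace.corner]
  rw [hG, iterFace_none]

theorem exists_chain_of_iterFace_eq {J : CubeFace m} {K : CubeFace n} {c : X.cube m}
    {e : X.cube n} (h : X.iterFace J c = X.iterFace K e) {L : List (CubeFace m)}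
    (hL : Chain (src J) L (tgt J)) :
    ∃ L' : List (CubeFace n), Chain (src K) L' (tgt K) ∧
      L'.map (fun G => X.iterFace G e) = L.map (fun G => X.iterFace G c) := by
  obtain ⟨φ⟩ := exists_orderIso_of_iterFace_eq h
  have htransfer : ∀ G ∈ L, X.iterFace (CubeFace.transfer J K φ G) e = X.iterFace G c :=
    fun G hG => iterFace_transfer φ h (CubeFace.isSubface_of_chain hL hG)
  refine ⟨L.map (CubeFace.transfer J K φ), ?_, ?_⟩
  · have hφ := CubeFace.preservesEnds_transfer φ
    have := hL.map hφ fun G hG hv =>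
      isVertex_iterFace_iff.mp (htransfer G hG ▸ isVertex_iterFace_iff.mpr hv)
    rwa [hφ.map_src, hφ.map_tgt, CubeFace.transfer_self] at this
  · rw [List.map_map]
    exact List.map_congr_left htransfer

theorem refinesCell_iterFace_iff {K : CubeFace n} {e : X.cube n} {l : List X.Cell} :
    RefinesCell (X.iterFace K e) l ↔
      ∃ L : List (CubeFace n), Chain (src K) L (tgt K) ∧
        L.map (fun G => X.iterFace G e) = l := by
  have h : X.iterFace (fun _ => none) (X.iterFace K e).2 = X.iterFace K e := iterFace_none _
  constructor
  · rintro ⟨L, hL, rfl⟩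
    exact exists_chain_of_iterFace_eq h hL
  · rintro ⟨L, hL, rfl⟩
    exact exists_chain_of_iterFace_eq h.symm hL

theorem refinesCell_append_iff {e : X.Cell} {l l' : List X.Cell} :
    RefinesCell e (l ++ l') ↔ ∃ J : Set (Fin e.1), RefinesCell (X.splitFirst J e.2) l ∧
      RefinesCell (X.splitSecond J e.2) l' := by
  have hfirst (J : Set (Fin e.1)) := refinesCell_iterFace_iff (K := CubeFace.splitFirst J)
    (e := e.2) (l := l)
  have hsecond (J : Set (Fin e.1)) := refinesCell_iterFace_iff (K := CubeFace.splitSecond J)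
    (e := e.2) (l := l')
  simp only [CubeFace.src_splitFirst, CubeFace.tgt_splitFirst] at hfirst
  simp only [CubeFace.src_splitSecond, CubeFace.tgt_splitSecond] at hsecond
  constructor
  · rintro ⟨L, hL, hl⟩
    obtain ⟨L₁, L₂, rfl, rfl, rfl⟩ := List.map_eq_append_iff.mp hl
    obtain ⟨v, h₁, h₂⟩ := Chain.append_iff.mp hL
    obtain ⟨J, rfl⟩ := CubeFace.exists_eq_splitVertex (h₁.isVertex_right rfl)
    exact ⟨J, (hfirst J).mpr ⟨L₁, h₁, rfl⟩, (hsecond J).mpr ⟨L₂, h₂, rfl⟩⟩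
  · rintro ⟨J, h₁, h₂⟩
    obtain ⟨L₁, hL₁, rfl⟩ := (hfirst J).mp h₁
    obtain ⟨L₂, hL₂, rfl⟩ := (hsecond J).mp h₂
    exact ⟨L₁ ++ L₂, Chain.append_iff.mpr ⟨_, hL₁, hL₂⟩, List.map_append⟩

theorem src_splitSecond (J : Set (Fin n)) (e : X.cube n) :
    src (X.splitSecond J e) = tgt (X.splitFirst J e) :=
  ((preservesEnds_iterFace e).map_src (CubeFace.splitSecond J)).symm.trans <|
    (congrArg (X.iterFace · e)
      ((CubeFace.src_splitSecond J).trans (CubeFace.tgt_splitFirst J).symm)).trans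
    ((preservesEnds_iterFace e).map_tgt (CubeFace.splitFirst J))

theorem tgt_splitSecond (J : Set (Fin n)) (e : X.cube n) :
    tgt (X.splitSecond J e) = tgt (⟨n, e⟩ : X.Cell) :=
  ((preservesEnds_iterFace e).map_tgt (CubeFace.splitSecond J)).symm.trans <|
    (congrArg (X.iterFace · e) (CubeFace.tgt_splitSecond J)).trans (iterFace_corner true e)

theorem dim_splitFirst_pos_iff {J : Set (Fin n)} {e : X.cube n} :
    0 < (X.splitFirst J e).1 ↔ J ≠ univ := by
  rw [← not_isVertex_iff, Ne, ← CubeFace.isVertex_splitFirst_iff]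
  exact isVertex_iterFace_iff.not

theorem dim_splitSecond_pos_iff {J : Set (Fin n)} {e : X.cube n} :
    0 < (X.splitSecond J e).1 ↔ J ≠ ∅ := by
  rw [← not_isVertex_iff, Ne, ← CubeFace.isVertex_splitSecond_iff]
  exact isVertex_iterFace_iff.not

/-- Refinement of lists of cubes, piece by piece. -/
def RefinesList : List X.Cell → List X.Cell → Prop
  | [], l => l = []
  | e :: es, l => ∃ l₁ l₂, l = l₁ ++ l₂ ∧ RefinesCell e l₁ ∧ RefinesList es l₂

theorem refinesList_nil_iff {l : List X.Cell} : RefinesList [] l ↔ l = [] := Iff.rfl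

theorem refinesList_cons_iff {e : X.Cell} {es l : List X.Cell} :
    RefinesList (e :: es) l ↔
      ∃ l₁ l₂, l = l₁ ++ l₂ ∧ RefinesCell e l₁ ∧ RefinesList es l₂ := Iff.rfl

theorem refinesList_append_iff {es es' l : List X.Cell} :
    RefinesList (es ++ es') l ↔
      ∃ l₁ l₂, l = l₁ ++ l₂ ∧ RefinesList es l₁ ∧ RefinesList es' l₂ := by
  induction es generalizing l with
  | nil => simp [refinesList_nil_iff]
  | cons e es ih =>
    simp only [List.cons_append, refinesList_cons_iff, ih]
    constructor
    · rintro ⟨l₁, _, rfl, h, l₂, l₃, rfl, h₂, h₃⟩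
      exact ⟨l₁ ++ l₂, l₃, by simp, ⟨l₁, l₂, rfl, h, h₂⟩, h₃⟩
    · rintro ⟨_, l₃, rfl, ⟨l₁, l₂, rfl, h, h₂⟩, h₃⟩
      exact ⟨l₁, l₂ ++ l₃, by simp, h, l₂, l₃, rfl, h₂, h₃⟩

theorem refinesList_singleton_iff {e : X.Cell} {l : List X.Cell} :
    RefinesList [e] l ↔ RefinesCell e l := by
  simp [refinesList_cons_iff, refinesList_nil_iff]

theorem refinesList_cons_iff_of_dim_eq_zero {e : X.Cell} (he : e.1 = 0) {es l : List X.Cell} :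
    RefinesList (e :: es) l ↔ RefinesList es l := by
  simp [refinesList_cons_iff, refinesCell_iff_of_dim_eq_zero he]

theorem refinesList_self {l : List X.Cell} (h : ∀ e ∈ l, 0 < e.1) : RefinesList l l := by
  induction l with
  | nil => rfl
  | cons e es ih =>
    rw [List.forall_mem_cons] at h
    exact ⟨[e], es, rfl, refinesCell_self h.1, ih h.2⟩

theorem RefinesList.chain {u v : X.Cell} {l l' : List X.Cell} (h : RefinesList l l')
    (hl : Chain u l v) : Chain u l' v := by
  induction l generalizing u l' with
  | nil => exact refinesList_nil_iff.mp h ▸ hl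
  | cons e es ih =>
    obtain ⟨-, rfl, hes⟩ := hl
    obtain ⟨l₁, l₂, rfl, h₁, h₂⟩ := h
    exact Chain.append_iff.mpr ⟨_, h₁.chain, ih h₂ hes⟩

/-- `l'` arises from `l` by an elementary refinement of one cube. In contrast to
`CubeChain.ElementaryRefines` the lists need not be chains, so that the relation is stable under
adding cubes on both sides. -/
def ElemRefinesList (l l' : List X.Cell) : Prop :=
  ∃ (L R : List X.Cell) (n : ℕ) (e : X.cube n) (J : Set (Fin n)),
    J ≠ ∅ ∧ J ≠ univ ∧ l = L ++ ⟨n, e⟩ :: R ∧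
      l' = L ++ X.splitFirst J e :: X.splitSecond J e :: R

theorem ElemRefinesList.append {l l' : List X.Cell} (h : ElemRefinesList l l')
    (A B : List X.Cell) : ElemRefinesList (A ++ l ++ B) (A ++ l' ++ B) := by
  obtain ⟨L, R, n, e, J, h₁, h₂, rfl, rfl⟩ := h
  exact ⟨A ++ L, R ++ B, n, e, J, h₁, h₂, by simp, by simp⟩

theorem reflTransGen_elemRefinesList_append {l l' : List X.Cell}
    (h : Relation.ReflTransGen ElemRefinesList l l') (A B : List X.Cell) :
    Relation.ReflTransGen ElemRefinesList (A ++ l ++ B) (A ++ l' ++ B) :=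
  h.lift (fun m => A ++ m ++ B) fun _ _ h => h.append A B

theorem RefinesList.of_elemRefinesList {l l' l'' : List X.Cell} (h : ElemRefinesList l l')
    (h' : RefinesList l' l'') : RefinesList l l'' := by
  obtain ⟨L, R, n, e, J, -, -, rfl, rfl⟩ := h
  obtain ⟨l₁, _, rfl, hL, l₂, _, rfl, hfirst, l₃, l₄, rfl, hsecond, hR⟩ :=
    refinesList_append_iff.mp h'
  exact refinesList_append_iff.mpr ⟨l₁, _, rfl, hL, l₂ ++ l₃, l₄, by simp,
    refinesCell_append_iff.mpr ⟨J, hfirst, hsecond⟩, hR⟩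

theorem ElemRefinesList.dim_pos {l l' : List X.Cell} (h : ElemRefinesList l l')
    (hl : ∀ e ∈ l, 0 < e.1) : ∀ e ∈ l', 0 < e.1 := by
  obtain ⟨L, R, n, e, J, hJ, hJ', rfl, rfl⟩ := h
  simp only [List.forall_mem_append, List.forall_mem_cons] at hl ⊢
  exact ⟨hl.1, dim_splitFirst_pos_iff.mpr hJ', dim_splitSecond_pos_iff.mpr hJ, hl.2.2⟩

theorem ElemRefinesList.refinesList {l l' : List X.Cell} (h : ElemRefinesList l l')
    (hl : ∀ e ∈ l, 0 < e.1) : RefinesList l l' :=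
  .of_elemRefinesList h (refinesList_self (h.dim_pos hl))

theorem RefinesCell.reflTransGen {e : X.Cell} {l : List X.Cell} (he : 0 < e.1)
    (h : RefinesCell e l) : Relation.ReflTransGen ElemRefinesList [e] l := by
  induction l generalizing e with
  | nil => exact absurd (refinesCell_nil_iff.mp h) he.ne'
  | cons g l ih =>
    rcases eq_or_ne l [] with rfl | hl
    · rw [h.eq_of_singleton]
    · obtain ⟨J, hfirst, hsecond⟩ := (refinesCell_append_iff (l := [g])).mp h
      have hpos : 0 < (X.splitSecond J e.2).1 := Nat.pos_of_ne_zero fun h₀ =>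
        hl ((refinesCell_iff_of_dim_eq_zero h₀).mp hsecond)
      have hg : g = X.splitFirst J e.2 := hfirst.eq_of_singleton
      have hJ : J ≠ univ := dim_splitFirst_pos_iff.mp (hg ▸ hfirst.dim_pos List.mem_cons_self)
      have hsplit : ElemRefinesList [e] [g, X.splitSecond J e.2] :=
        ⟨[], [], e.1, e.2, J, dim_splitSecond_pos_iff.mp hpos, hJ, rfl, by rw [hg]; rfl⟩
      refine .head hsplit ?_
      simpa using reflTransGen_elemRefinesList_append (ih hpos hsecond) [g] []

theorem RefinesList.reflTransGen {es l : List X.Cell} (hes : ∀ e ∈ es, 0 < e.1)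
    (h : RefinesList es l) : Relation.ReflTransGen ElemRefinesList es l := by
  induction es generalizing l with
  | nil => rw [refinesList_nil_iff.mp h]
  | cons e es ih =>
    obtain ⟨l₁, l₂, rfl, h₁, h₂⟩ := h
    rw [List.forall_mem_cons] at hes
    have hhead := reflTransGen_elemRefinesList_append (h₁.reflTransGen hes.1) [] es
    have htail := reflTransGen_elemRefinesList_append (ih hes.2 h₂) l₁ []
    simp only [List.nil_append, List.append_nil] at hhead htail
    exact hhead.trans htail

theorem chain_iff_linked {a b : X.cube 0} {l : List X.Cell} :
    Chain (⟨0, a⟩ : X.Cell) l ⟨0, b⟩ ↔ X.Linked a l b ∧ ∀ c ∈ l, 0 < c.1 := by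
  induction l generalizing a with
  | nil => simp [Chain.nil_iff, Linked]
  | cons c cs ih =>
    have hsrc : src c = ⟨0, a⟩ ↔ X.endVertex false c.2 = a :=
      sigma_mk_injective.eq_iff (a := X.endVertex false c.2)
    rw [Chain.cons_iff, not_isVertex_iff, hsrc, show tgt c = ⟨0, X.endVertex true c.2⟩ from rfl,
      ih, Linked, List.forall_mem_cons]
    tauto

namespace CubeChain

variable {x y : X.cube 0}

theorem chain (c : X.CubeChain x y) : Chain (⟨0, x⟩ : X.Cell) c.cubes ⟨0, y⟩ :=
  chain_iff_linked.mpr ⟨c.linked, c.dim_pos⟩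

theorem exists_of_chain {l : List X.Cell} (h : Chain (⟨0, x⟩ : X.Cell) l ⟨0, y⟩) :
    ∃ c : X.CubeChain x y, c.cubes = l :=
  ⟨⟨l, (chain_iff_linked.mp h).2, (chain_iff_linked.mp h).1⟩, rfl⟩

theorem exists_refines_of_reflTransGen (c : X.CubeChain x y) {l : List X.Cell}
    (h : Relation.ReflTransGen ElemRefinesList c.cubes l) :
    ∃ d : X.CubeChain x y, d.cubes = l ∧ d.Refines c := by
  induction h with
  | refl => exact ⟨c, rfl, .refl⟩
  | tail _ hlast ih =>
    obtain ⟨d, rfl, hd⟩ := ih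
    obtain ⟨d', rfl⟩ := exists_of_chain ((hlast.refinesList d.dim_pos).chain d.chain)
    exact ⟨d', rfl, hd.tail hlast⟩

theorem refines_iff {c d : X.CubeChain x y} : d.Refines c ↔ RefinesList c.cubes d.cubes := by
  constructor
  · intro h
    induction h using Relation.ReflTransGen.head_induction_on with
    | refl => exact refinesList_self d.dim_pos
    | head hfirst _ ih => exact .of_elemRefinesList hfirst ih
  · intro h
    obtain ⟨d', hcubes, hd'⟩ := c.exists_refines_of_reflTransGen (h.reflTransGen c.dim_pos)
    rwa [CubeChain.ext hcubes] at hd'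

theorem Refines.eq_or_length_lt {c d : X.CubeChain x y} (h : d.Refines c) :
    d = c ∨ c.cubes.length < d.cubes.length := by
  induction h with
  | refl => exact .inl rfl
  | tail _ hlast ih =>
    obtain ⟨L, R, n, e, J, -, -, hc, hd⟩ := hlast
    rcases ih with rfl | ih
    · exact .inr (by simp [hc, hd])
    · exact .inr (ih.trans (by simp [hc, hd]))

theorem Refines.antisymm {c d : X.CubeChain x y} (h : d.Refines c) (h' : c.Refines d) :
    d = c := by
  rcases h.eq_or_length_lt with heq | hlt
  · exact heq
  · rcases h'.eq_or_length_lt with heq | hlt'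
    · exact heq.symm
    · exact absurd hlt' hlt.asymm

end CubeChain

theorem IsProper.eq_of_src_eq_of_tgt_eq (hX : X.IsProper) {c d : X.Cell} (hsrc : src c = src d)
    (htgt : tgt c = tgt d) : c = d :=
  hX c d (sigma_mk_injective hsrc) (sigma_mk_injective htgt)

theorem IsProper.eq_of_refinesCell (hX : X.IsProper) {c d : X.Cell} {l : List X.Cell}
    (hc : RefinesCell c l) (hd : RefinesCell d l) (hl : l ≠ []) : c = d := by
  have hsrc : src c = src d := hc.chain.unique_left hd.chain hl
  exact hX.eq_of_src_eq_of_tgt_eq hsrc (hc.chain.unique_right (hsrc ▸ hd.chain))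

/-- `s` is what is left of `e'` after the first piece `e`: together with `e` it refines `e'`, and
whenever a refinement of `e'` begins with a refinement of `e`, the rest of it refines `s`. -/
def IsComplementIn (s e e' : X.Cell) : Prop :=
  (∀ M, RefinesCell s M → RefinesCell e' (e :: M)) ∧
    ∀ D M, RefinesCell e D → RefinesCell e' (D ++ M) → RefinesCell s M

theorem IsProper.exists_isComplementIn (hX : X.IsProper) {e e' : X.Cell} (he : 0 < e.1)
    {D M : List X.Cell} (hD : RefinesCell e D) (hDM : RefinesCell e' (D ++ M)) :
    ∃ s, IsComplementIn s e e' := by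
  have hcut : ∀ D M, RefinesCell e D → RefinesCell e' (D ++ M) → ∃ J : Set (Fin e'.1),
      X.splitFirst J e'.2 = e ∧ RefinesCell (X.splitSecond J e'.2) M := by
    intro D M hD hDM
    obtain ⟨J, hfirst, hsecond⟩ := refinesCell_append_iff.mp hDM
    have hne : D ≠ [] := fun h => he.ne' (refinesCell_nil_iff.mp (h ▸ hD))
    exact ⟨J, hX.eq_of_refinesCell hfirst hD hne, hsecond⟩
  obtain ⟨J, hJ, -⟩ := hcut D M hD hDM
  refine ⟨X.splitSecond J e'.2, fun M hM => ?_, fun D' M' hD' hDM' => ?_⟩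
  · exact refinesCell_append_iff (l := [e]).mpr ⟨J, hJ.symm ▸ refinesCell_self he, hM⟩
  · obtain ⟨J', hJ', hM'⟩ := hcut D' M' hD' hDM'
    have hs : X.splitSecond J' e'.2 = X.splitSecond J e'.2 := by
      refine hX.eq_of_src_eq_of_tgt_eq ?_ ?_
      · rw [src_splitSecond, src_splitSecond, hJ, hJ']
      · rw [tgt_splitSecond, tgt_splitSecond]
    exact hs ▸ hM'

theorem RefinesList.exists_common_split {e e' : X.Cell} {es es' d : List X.Cell}
    (h : RefinesList (e :: es) d) (h' : RefinesList (e' :: es') d) (hle : e.1 ≤ e'.1) :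
    ∃ D M d', d = D ++ (M ++ d') ∧ RefinesCell e D ∧ RefinesCell e' (D ++ M) ∧
      RefinesList es (M ++ d') ∧ RefinesList es' d' := by
  obtain ⟨D, ds, rfl, hD, hds⟩ := h
  obtain ⟨D', ds', heq, hD', hds'⟩ := h'
  rcases List.append_eq_append_iff.mp heq with ⟨M, rfl, rfl⟩ | ⟨M, rfl, rfl⟩
  · exact ⟨D, M, ds', rfl, hD, hD', hds, hds'⟩
  · obtain rfl : M = [] := by
      cases M with
      | nil => rfl
      | cons c M =>
        have hc := hD.dim_pos (c := c) (by simp)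
        have hsum := hD.sum_dim.trans_le (hle.trans_eq hD'.sum_dim.symm)
        simp only [List.map_append, List.sum_append, List.map_cons, List.sum_cons] at hsum
        omega
    exact ⟨D', [], ds, by simp, by simpa using hD, by simpa using hD', by simpa using hds,
      by simpa using hds'⟩

/-- Among the common refinements of the lists `c` and `c'`, there is one which is refined by all
the others. -/
def HasCoarsestCommonRefinement (c c' : List X.Cell) : Prop :=
  ∃ E, RefinesList c E ∧ RefinesList c' E ∧
    ∀ d, RefinesList c d → RefinesList c' d → RefinesList E d

theorem HasCoarsestCommonRefinement.symm {c c' : List X.Cell}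
    (h : HasCoarsestCommonRefinement c c') : HasCoarsestCommonRefinement c' c :=
  let ⟨E, hc, hc', hE⟩ := h
  ⟨E, hc', hc, fun d hd hd' => hE d hd' hd⟩

theorem hasCoarsestCommonRefinement_nil {c d : List X.Cell} (hd : RefinesList [] d)
    (hd' : RefinesList c d) : HasCoarsestCommonRefinement [] c :=
  ⟨[], rfl, refinesList_nil_iff.mp hd ▸ hd', fun _ h _ => h⟩

theorem HasCoarsestCommonRefinement.cons {s e e' : X.Cell} {es es' : List X.Cell} (he : 0 < e.1)
    (hle : e.1 ≤ e'.1) (hs : IsComplementIn s e e')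
    (h : HasCoarsestCommonRefinement es (s :: es')) :
    HasCoarsestCommonRefinement (e :: es) (e' :: es') := by
  obtain ⟨E, hE, ⟨M, ds, rfl, hM, hds⟩, hE'⟩ := h
  refine ⟨e :: (M ++ ds), ⟨[e], _, rfl, refinesCell_self he, hE⟩, ⟨e :: M, ds, rfl, hs.1 M hM, hds⟩,
    fun d hd hd' => ?_⟩
  obtain ⟨D, N, d', rfl, hD, hDN, hes, hes'⟩ := hd.exists_common_split hd' hle
  exact ⟨D, N ++ d', rfl, hD, hE' _ hes ⟨N, d', rfl, hs.2 D N hD hDN, hes'⟩⟩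

theorem IsProper.hasCoarsestCommonRefinement (hX : X.IsProper) {c c' d : List X.Cell}
    (hd : RefinesList c d) (hd' : RefinesList c' d) : HasCoarsestCommonRefinement c c' := by
  induction hN : c.length + c'.length using Nat.strong_induction_on generalizing c c' d with
  | _ N ih =>
  subst hN
  match c, c' with
  | [], c' => exact hasCoarsestCommonRefinement_nil hd hd'
  | c, [] => exact (hasCoarsestCommonRefinement_nil hd' hd).symm
  | e :: es, e' :: es' =>
    wlog hle : e.1 ≤ e'.1 generalizing e e' es es'
    · refine (this e' es' e es hd' hd (fun N hN c c' d hd hd' hc => ?_) (le_of_not_ge hle)).symm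
      exact ih N (by omega) hd hd' hc
    rcases Nat.eq_zero_or_pos e.1 with he | he
    · simp only [refinesList_cons_iff_of_dim_eq_zero he, HasCoarsestCommonRefinement] at hd ⊢
      exact ih _ (by simp) hd hd' rfl
    · obtain ⟨D, M, d', rfl, hD, hDM, hes, hes'⟩ := hd.exists_common_split hd' hle
      obtain ⟨s, hs⟩ := hX.exists_isComplementIn he hD hDM
      refine .cons he hle hs (ih _ ?_ hes ⟨M, d', rfl, hs.2 D M hD hDM, hes'⟩ rfl)
      simp

theorem IsProper.exists_isCoarsestCommonRefinement (hX : X.IsProper) {x y : X.cube 0}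
    {c c' d : X.CubeChain x y} (hd : d.IsCommonRefinement c c') :
    ∃ E : X.CubeChain x y, E.IsCoarsestCommonRefinement c c' := by
  simp only [CubeChain.IsCoarsestCommonRefinement, CubeChain.IsCommonRefinement,
    CubeChain.refines_iff] at hd ⊢
  obtain ⟨E, hc, hc', hE⟩ := hX.hasCoarsestCommonRefinement hd.1 hd.2
  obtain ⟨E, rfl⟩ := CubeChain.exists_of_chain (hc.chain c.chain)
  exact ⟨E, ⟨hc, hc'⟩, fun f hf => hE _ hf.1 hf.2⟩

end PrecubicalSet

theorem rel_of_forall_eventually_nhdsGT_nhdsLT {T : Type*} [ConditionallyCompleteLinearOrder T]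
    [TopologicalSpace T] [OrderTopology T] [DenselyOrdered T] {R : T → T → Prop}
    (hrefl : ∀ r, R r r) (htrans : ∀ r s t, R r s → R s t → R r t) {a b : T} (hab : a ≤ b)
    (hr : ∀ s ∈ Ico a b, ∀ᶠ t in 𝓝[>] s, R s t) (hl : ∀ s ∈ Ioc a b, ∀ᶠ t in 𝓝[<] s, R t s) :
    R a b := by
  set S : Set T := {t | t ∈ Icc a b ∧ R a t}
  have haS : a ∈ S := ⟨left_mem_Icc.mpr hab, hrefl a⟩
  obtain ⟨c, hlub⟩ : ∃ c, IsLUB S c := ⟨_, isLUB_csSup ⟨a, haS⟩ ⟨b, fun t ht => ht.1.2⟩⟩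
  have hac : a ≤ c := hlub.1 haS
  have hcb : c ≤ b := hlub.2 fun t ht => ht.1.2
  have hRc : R a c := by
    rcases hac.eq_or_lt with rfl | hac
    · exact hrefl a
    · obtain ⟨l, hlc, hlsub⟩ := (mem_nhdsLT_iff_exists_Ioo_subset' hac).mp (hl c ⟨hac, hcb⟩)
      obtain ⟨t, htS, hlt, htc⟩ := hlub.exists_between hlc
      rcases htc.eq_or_lt with rfl | htc
      · exact htS.2
      · exact htrans a t c htS.2 (hlsub ⟨hlt, htc⟩)
  rcases hcb.eq_or_lt with rfl | hcb
  · exact hRc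
  · have := nhdsGT_neBot_of_exists_gt ⟨b, hcb⟩
    obtain ⟨t, ht, hct, htb⟩ := ((hr c ⟨hac, hcb⟩).and (Ioo_mem_nhdsGT hcb)).exists
    exact absurd (hlub.1 ⟨⟨hac.trans hct.le, htb.le⟩, htrans a c t hRc ht⟩) hct.not_ge

theorem eventually_nhdsWithin_Icc {T : Type*} [LinearOrder T] [TopologicalSpace T]
    {P : T → Prop} {a b s : T} (hs : P s) (hl : a < s → ∀ᶠ t in 𝓝[<] s, P t)
    (hr : s < b → ∀ᶠ t in 𝓝[>] s, P t) : ∀ᶠ t in 𝓝[Icc a b] s, P t := by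
  have hl' : ∀ᶠ t in 𝓝[<] s, t ∈ Icc a b → P t := by
    by_cases has : a < s
    · exact (hl has).mono fun t ht _ => ht
    · filter_upwards [self_mem_nhdsWithin] with t hts ht
      exact absurd (ht.1.trans_lt hts) has
  have hr' : ∀ᶠ t in 𝓝[>] s, t ∈ Icc a b → P t := by
    by_cases hsb : s < b
    · exact (hr hsb).mono fun t ht _ => ht
    · filter_upwards [self_mem_nhdsWithin] with t hst ht
      exact absurd (lt_of_lt_of_le hst ht.2) hsb
  rw [eventually_nhdsWithin_iff] at hl' hr' ⊢
  filter_upwards [hl', hr'] with t hlt hgt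
  rcases lt_trichotomy t s with h | rfl | h
  exacts [hlt h, fun _ => hs, hgt h]

section StepFunctions

variable {T C D : Type*} [HasEnds C] [HasEnds D] {a b c : T} {ts ts' : List T}

section StepOn

variable [LinearOrder T] [TopologicalSpace T] {N : T → C}

/-- `N` is a step function on `[a, b]`: immediately after each time it takes the target of its
current value, and immediately before each time the source. -/
def StepOn (N : T → C) (a b : T) : Prop :=
  (∀ s ∈ Ico a b, ∀ᶠ t in 𝓝[>] s, N t = tgt (N s)) ∧
    ∀ s ∈ Ioc a b, ∀ᶠ t in 𝓝[<] s, N t = src (N s)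

theorem StepOn.refl (N : T → C) (a : T) : StepOn N a a := by simp [StepOn]

theorem StepOn.trans (h : StepOn N a b) (h' : StepOn N b c) : StepOn N a c := by
  refine ⟨fun s hs => ?_, fun s hs => ?_⟩
  · rcases lt_or_ge s b with hsb | hbs
    · exact h.1 s ⟨hs.1, hsb⟩
    · exact h'.1 s ⟨hbs, hs.2⟩
  · rcases lt_or_ge b s with hbs | hsb
    · exact h'.2 s ⟨hbs, hs.2⟩
    · exact h.2 s ⟨hs.1, hsb⟩

theorem StepOn.mono (h : StepOn N a b) {a' b' : T} (ha : a ≤ a') (hb : b' ≤ b) : StepOn N a' b' :=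
  ⟨fun s hs => h.1 s (Ico_subset_Ico ha hb hs), fun s hs => h.2 s (Ioc_subset_Ioc ha hb hs)⟩

theorem StepOn.of_eventually_map [OrderTopology T] {F : T → D} (h : StepOn N a b)
    (hF : ∀ s ∈ Icc a b, ∃ f : C → D, PreservesEnds f ∧
      ∀ᶠ t in 𝓝[Icc a b] s, F t = f (N t)) : StepOn F a b := by
  refine ⟨fun s hs => ?_, fun s hs => ?_⟩
  · have hsI := Ico_subset_Icc_self hs
    obtain ⟨f, hf, hFN⟩ := hF s hsI
    filter_upwards [h.1 s hs, nhdsWithin_le_of_mem (Icc_mem_nhdsGT_of_mem hs) hFN] with t ht htF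
    rw [htF, hFN.self_of_nhdsWithin hsI, ht, hf.map_tgt]
  · have hsI := Ioc_subset_Icc_self hs
    obtain ⟨f, hf, hFN⟩ := hF s hsI
    filter_upwards [h.2 s hs, nhdsWithin_le_of_mem (Icc_mem_nhdsLT_of_mem hs) hFN] with t ht htF
    rw [htF, hFN.self_of_nhdsWithin hsI, ht, hf.map_src]

theorem StepOn.map [OrderTopology T] {F : T → D} (h : StepOn N a b) {f : C → D}
    (hf : PreservesEnds f) (hF : ∀ t ∈ Icc a b, F t = f (N t)) : StepOn F a b :=
  h.of_eventually_map fun _ _ => ⟨f, hf, eventually_nhdsWithin_of_forall hF⟩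

theorem stepOn_of_forall_mem_Ioo [OrderTopology T] (hN : ∀ t ∈ Ioo a b, N t = tgt (N a))
    (hb : tgt (N a) = src (N b)) : StepOn N a b := by
  refine ⟨fun s hs => ?_, fun s hs => ?_⟩
  · filter_upwards [Ioo_mem_nhdsGT hs.2] with t ht
    rw [hN t ⟨hs.1.trans_lt ht.1, ht.2⟩]
    rcases hs.1.eq_or_lt with rfl | has
    · rfl
    · rw [hN s ⟨has, hs.2⟩, (isVertex_tgt _).tgt_eq]
  · filter_upwards [Ioo_mem_nhdsLT hs.1] with t ht
    rw [hN t ⟨ht.1, ht.2.trans_le hs.2⟩]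
    rcases hs.2.eq_or_lt with rfl | hsb
    · exact hb
    · rw [hN s ⟨hs.1, hsb⟩, isVertex_tgt]

end StepOn

section CrossingSeq

variable [LinearOrder T] {N : T → C}

/-- `ts` is the increasing sequence of the times in `(a, b]` at which the step function `N` crosses
a cell which is not a vertex. Between these times `N` is constant. -/
def IsCrossingSeq (N : T → C) : T → List T → T → Prop
  | a, [], b => a ≤ b ∧ ∀ t ∈ Ioc a b, N t = tgt (N a)
  | a, m :: ts, b => a < m ∧ ¬IsVertex (N m) ∧ (∀ t ∈ Ioo a m, N t = tgt (N a)) ∧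
      tgt (N a) = src (N m) ∧ IsCrossingSeq N m ts b

namespace IsCrossingSeq

theorem refl (N : T → C) (a : T) : IsCrossingSeq N a [] a := by simp [IsCrossingSeq]

theorem le (h : IsCrossingSeq N a ts b) : a ≤ b := by
  induction ts generalizing a with
  | nil => exact h.1
  | cons m ts ih => exact h.1.le.trans (ih h.2.2.2.2)

theorem mem_iff (h : IsCrossingSeq N a ts b) {t : T} :
    t ∈ ts ↔ t ∈ Ioc a b ∧ ¬IsVertex (N t) := by
  induction ts generalizing a with
  | nil =>
    refine ⟨fun ht => by simp at ht, fun ⟨ht, hN⟩ => absurd ?_ hN⟩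
    rw [h.2 t ht]
    exact isVertex_tgt _
  | cons m ts ih =>
    obtain ⟨ham, hm, hconst, -, h⟩ := h
    rw [List.mem_cons, ih h]
    refine ⟨?_, fun ⟨ht, hN⟩ => ?_⟩
    · rintro (rfl | ⟨ht, hN⟩)
      · exact ⟨⟨ham, h.le⟩, hm⟩
      · exact ⟨⟨ham.trans ht.1, ht.2⟩, hN⟩
    · rcases lt_trichotomy t m with htm | rfl | hmt
      · rw [hconst t ⟨ht.1, htm⟩] at hN
        exact absurd (isVertex_tgt _) hN
      · exact Or.inl rfl
      · exact Or.inr ⟨⟨hmt, ht.2⟩, hN⟩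

theorem sortedLT (h : IsCrossingSeq N a ts b) : ts.SortedLT := by
  rw [List.sortedLT_iff_pairwise]
  induction ts generalizing a with
  | nil => exact List.Pairwise.nil
  | cons m ts ih =>
    obtain ⟨-, -, -, -, h⟩ := h
    exact List.Pairwise.cons (fun t ht => (h.mem_iff.mp ht).1.1) (ih h)

theorem extend_left (h : IsCrossingSeq N a [] b) (h' : IsCrossingSeq N b ts' c) :
    IsCrossingSeq N a ts' c := by
  obtain ⟨hab, hconst⟩ := h
  rcases hab.eq_or_lt with rfl | hab
  · exact h'
  have hb : N b = tgt (N a) := hconst b ⟨hab, le_rfl⟩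
  have hb' : tgt (N b) = tgt (N a) := by rw [hb, (isVertex_tgt _).tgt_eq]
  cases ts' with
  | nil =>
    refine ⟨hab.le.trans h'.1, fun t ht => ?_⟩
    rcases le_or_gt t b with htb | hbt
    · exact hconst t ⟨ht.1, htb⟩
    · rw [h'.2 t ⟨hbt, ht.2⟩, hb']
  | cons m ts =>
    obtain ⟨hbm, hm, hconst', hsrc, h'⟩ := h'
    refine ⟨hab.trans hbm, hm, fun t ht => ?_, hb'.symm.trans hsrc, h'⟩
    rcases le_or_gt t b with htb | hbt
    · exact hconst t ⟨ht.1, htb⟩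
    · rw [hconst' t ⟨hbt, ht.2⟩, hb']

theorem append (h : IsCrossingSeq N a ts b) (h' : IsCrossingSeq N b ts' c) :
    IsCrossingSeq N a (ts ++ ts') c := by
  induction ts generalizing a with
  | nil => exact h.extend_left h'
  | cons m ts ih =>
    obtain ⟨ham, hm, hconst, hsrc, h⟩ := h
    exact ⟨ham, hm, hconst, hsrc, ih h⟩

theorem map {F : T → D} (h : IsCrossingSeq N a ts b) {f : C → D} (hf : PreservesEnds f)
    (hv : ∀ c, IsVertex (f c) → IsVertex c) (hF : ∀ t ∈ Icc a b, F t = f (N t)) :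
    IsCrossingSeq F a ts b := by
  have ha : tgt (F a) = f (tgt (N a)) := by rw [hF a ⟨le_rfl, h.le⟩, hf.map_tgt]
  induction ts generalizing a with
  | nil => exact ⟨h.1, fun t ht => by rw [hF t (Ioc_subset_Icc_self ht), h.2 t ht, ha]⟩
  | cons m ts ih =>
    obtain ⟨ham, hm, hconst, hsrc, h⟩ := h
    have hFm : F m = f (N m) := hF m ⟨ham.le, h.le⟩
    refine ⟨ham, fun hv' => hm (hv _ (hFm ▸ hv')), fun t ht => ?_, ?_, ?_⟩
    · rw [hF t ⟨ht.1.le, ht.2.le.trans h.le⟩, hconst t ht, ha]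
    · rw [ha, hFm, hsrc, hf.map_src]
    · exact ih h (fun t ht => hF t ⟨ham.le.trans ht.1, ht.2⟩) (by rw [hFm, hf.map_tgt])

theorem congr {F : T → C} (h : IsCrossingSeq N a ts b) (hF : ∀ t ∈ Icc a b, F t = N t) :
    IsCrossingSeq F a ts b :=
  h.map (f := id) ⟨fun _ => rfl, fun _ => rfl⟩ (fun _ hc => hc) hF

theorem chain (h : IsCrossingSeq N a ts b) (hb : IsVertex (N b)) :
    Chain (tgt (N a)) (ts.map N) (N b) := by
  induction ts generalizing a with
  | nil =>
    rcases h.1.eq_or_lt with rfl | hab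
    · exact hb.tgt_eq
    · exact (h.2 b ⟨hab, le_rfl⟩).symm
  | cons m ts ih => exact ⟨h.2.1, h.2.2.2.1.symm, ih h.2.2.2.2⟩

theorem exists_vertex [DenselyOrdered T] (h : IsCrossingSeq N a ts b) (hb : IsVertex (N b)) :
    ∃ q, IsVertex (N q) ∧ IsCrossingSeq N a [] q ∧ IsCrossingSeq N q ts b := by
  cases ts with
  | nil => exact ⟨b, hb, h, refl N b⟩
  | cons m ts =>
    obtain ⟨ham, hm, hconst, hsrc, h⟩ := h
    obtain ⟨q, haq, hqm⟩ := exists_between ham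
    have hq : N q = tgt (N a) := hconst q ⟨haq, hqm⟩
    have hq' : tgt (N q) = tgt (N a) := by rw [hq, (isVertex_tgt _).tgt_eq]
    refine ⟨q, hq ▸ isVertex_tgt _, ⟨haq.le, fun t ht => hconst t ⟨ht.1, ht.2.trans_lt hqm⟩⟩,
      hqm, hm, fun t ht => ?_, hq'.trans hsrc, h⟩
    rw [hconst t ⟨haq.trans ht.1, ht.2⟩, hq']

theorem exists_cut [DenselyOrdered T] (h : IsCrossingSeq N a (ts ++ ts') b)
    (hb : IsVertex (N b)) :
    ∃ q, IsVertex (N q) ∧ IsCrossingSeq N a ts q ∧ IsCrossingSeq N q ts' b := by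
  induction ts generalizing a with
  | nil => exact h.exists_vertex hb
  | cons m ts ih =>
    obtain ⟨ham, hm, hconst, hsrc, h⟩ := h
    obtain ⟨q, hq, h₁, h₂⟩ := ih h
    exact ⟨q, hq, ⟨ham, hm, hconst, hsrc, h₁⟩, h₂⟩

theorem exists_lift {F : T → D} {f : C → D} (h : IsCrossingSeq F a ts b) (hf : PreservesEnds f)
    {u w : C} (hu : F a = f u) {L : List C} (hL : Chain (tgt u) L w) (hmap : L.map f = ts.map F) :
    ∃ N : T → C, N a = u ∧ tgt (N b) = w ∧ IsCrossingSeq N a ts b ∧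
      ∀ t ∈ Icc a b, F t = f (N t) := by
  induction ts generalizing a u L with
  | nil =>
    obtain rfl : L = [] := List.map_eq_nil_iff.mp hmap
    obtain ⟨hab, hconst⟩ := h
    refine ⟨fun t => if t ≤ a then u else tgt u, if_pos le_rfl, ?_, ⟨hab, fun t ht => ?_⟩,
      fun t ht => ?_⟩
    · dsimp only
      split_ifs
      exacts [hL, (isVertex_tgt u).tgt_eq.trans hL]
    · simp only [ht.1.not_ge, le_rfl, if_false, if_true]
    · rcases ht.1.eq_or_lt with rfl | hat
      · simpa using hu
      · simp only [hat.not_ge, if_false, hconst t ⟨hat, ht.2⟩, hu, hf.map_tgt]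
  | cons m ts ih =>
    obtain ⟨u', L, rfl, hu', hmap⟩ := List.map_eq_cons_iff.mp hmap
    obtain ⟨hv, hsrc', hL⟩ := hL
    obtain ⟨ham, -, hconst, -, h⟩ := h
    obtain ⟨N, hNm, hNb, hN, hFN⟩ := ih h hu'.symm hL hmap
    set N' : T → C := fun t => if t ≤ a then u else if t < m then tgt u else N t
    have hN'a : N' a = u := if_pos le_rfl
    have hN'lt : ∀ t ∈ Ioo a m, N' t = tgt u := fun t ht => by simp [N', ht.1.not_ge, ht.2]
    have hN'ge : ∀ t, m ≤ t → N' t = N t := fun t ht => by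
      simp [N', (ham.trans_le ht).not_ge, ht.not_gt]
    have hN'm : N' m = u' := (hN'ge m le_rfl).trans hNm
    refine ⟨N', hN'a, (hN'ge b h.le).symm ▸ hNb, ⟨ham, ?_, ?_, ?_, hN.congr fun t ht =>
      hN'ge t ht.1⟩, fun t ht => ?_⟩
    · rwa [hN'm]
    · rwa [hN'a]
    · rw [hN'a, hN'm, hsrc']
    · rcases ht.1.eq_or_lt with rfl | hat
      · rw [hN'a, hu]
      rcases lt_or_ge t m with htm | hmt
      · rw [hN'lt t ⟨hat, htm⟩, hconst t ⟨hat, htm⟩, hu, hf.map_tgt]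
      · rw [hN'ge t hmt, hFN t ⟨hmt, ht.2⟩]

theorem stepOn [TopologicalSpace T] [OrderTopology T] (h : IsCrossingSeq N a ts b)
    (hb : IsVertex (N b)) : StepOn N a b := by
  induction ts generalizing a with
  | nil =>
    refine stepOn_of_forall_mem_Ioo (fun t ht => h.2 t (Ioo_subset_Ioc_self ht)) ?_
    exact (h.chain hb : tgt (N a) = N b).trans hb.symm
  | cons m ts ih =>
    obtain ⟨-, -, hconst, hsrc, h⟩ := h
    exact (stepOn_of_forall_mem_Ioo hconst hsrc).trans (ih h)

end IsCrossingSeq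

end CrossingSeq

theorem StepOn.exists_isCrossingSeq [ConditionallyCompleteLinearOrder T] [TopologicalSpace T]
    [OrderTopology T] [DenselyOrdered T] {N : T → C} (h : StepOn N a b) (hab : a ≤ b) :
    ∃ ts, IsCrossingSeq N a ts b := by
  refine rel_of_forall_eventually_nhdsGT_nhdsLT (R := fun r s => ∃ ts, IsCrossingSeq N r ts s)
    (fun r => ⟨[], .refl N r⟩) (fun r s t ⟨ts, h⟩ ⟨ts', h'⟩ => ⟨ts ++ ts', h.append h'⟩) hab
    (fun s hs => ?_) fun s hs => ?_
  · obtain ⟨r, hsr, hr⟩ := (mem_nhdsGT_iff_exists_Ioo_subset' hs.2).mp (h.1 s hs)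
    filter_upwards [Ioo_mem_nhdsGT hsr] with t ht
    exact ⟨[], ht.1.le, fun u hu => hr ⟨hu.1, hu.2.trans_lt ht.2⟩⟩
  · obtain ⟨r, hrs, hr⟩ := (mem_nhdsLT_iff_exists_Ioo_subset' hs.1).mp (h.2 s hs)
    filter_upwards [Ioo_mem_nhdsLT hrs] with t ht
    have hN : ∀ u ∈ Ico t s, N u = src (N s) := fun u hu => hr ⟨ht.1.trans_le hu.1, hu.2⟩
    have ht' : tgt (N t) = src (N s) := by
      rw [hN t ⟨le_rfl, ht.2⟩, (isVertex_src _).tgt_eq]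
    by_cases hv : IsVertex (N s)
    · refine ⟨[], ht.2.le, fun u hu => ?_⟩
      rcases hu.2.eq_or_lt with rfl | hus
      · rw [ht', hv]
      · rw [ht', hN u ⟨hu.1.le, hus⟩]
    · exact ⟨[s], ht.2, hv, fun u hu => by rw [ht', hN u ⟨hu.1.le, hu.2⟩], ht', .refl N s⟩

end StepFunctions

namespace CubeFace

variable {n : ℕ} {x : Fin n → I}

theorem nearest_eq_some_false_iff {i : Fin n} :
    nearest x i = some false ↔ (x i : ℝ) < 1 / 2 := by
  unfold nearest; grind

theorem nearest_eq_some_true_iff {i : Fin n} :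
    nearest x i = some true ↔ 1 / 2 < (x i : ℝ) := by
  unfold nearest; grind

theorem nearest_eq_none_iff {i : Fin n} : nearest x i = none ↔ (x i : ℝ) = 1 / 2 := by
  unfold nearest; grind

theorem mem_collar_iff {J : CubeFace n} : x ∈ collar J ↔ (nearest x).IsSubface J := by
  simp only [collar, mem_ofPred_eq, IsSubface, Bool.forall_bool, nearest_eq_some_false_iff,
    nearest_eq_some_true_iff]

theorem IsSubface.eq_src {G J : CubeFace n} (h : G.IsSubface J)
    (hfree : ∀ i, J i = none → G i = some false) : G = src J := by
  funext i
  rw [src_apply]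
  cases hJ : J i with
  | none => exact hfree i hJ
  | some α => exact h i α hJ

theorem IsSubface.eq_tgt {G J : CubeFace n} (h : G.IsSubface J)
    (hfree : ∀ i, J i = none → G i = some true) : G = tgt J := by
  funext i
  rw [tgt_apply]
  cases hJ : J i with
  | none => exact hfree i hJ
  | some α => exact h i α hJ

theorem isOpen_collar (J : CubeFace n) : IsOpen (collar J) := by
  simp only [collar, ofPred_forall, ofPred_and]
  refine isOpen_iInter_of_finite fun i => .inter ?_ ?_ <;>
  · refine isOpen_iInter_of_finite fun _ => ?_
    exact isOpen_lt (by fun_prop) (by fun_prop)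

theorem eventually_nearest_isSubface {ι : Type*} {l : Filter ι} {β : ι → Fin n → I}
    (hβ : Tendsto β l (𝓝 x)) : ∀ᶠ t in l, (nearest (β t)).IsSubface (nearest x) :=
  (hβ.eventually ((isOpen_collar _).mem_nhds (mem_collar_iff.mpr (.refl _)))).mono
    fun _ => mem_collar_iff.mp

theorem stepOn_nearest {T : Type*} [LinearOrder T] [TopologicalSpace T] [OrderTopology T]
    {β : T → Fin n → I} {a b : T} (hc : ContinuousOn β (Icc a b)) (hm : MonotoneOn β (Icc a b))
    (hβ : ∀ i, ∀ s ∈ Icc a b, ∀ t ∈ Icc a b, s < t → (β s i : ℝ) = 1 / 2 → (β t i : ℝ) ≠ 1 / 2) :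
    StepOn (fun t => nearest (β t)) a b := by
  refine ⟨fun s hs => ?_, fun s hs => ?_⟩
  · have hsI := Ico_subset_Icc_self hs
    have hIcc := Icc_mem_nhdsGT_of_mem hs
    filter_upwards [hIcc, self_mem_nhdsWithin, eventually_nearest_isSubface
      ((hc s hsI).mono_left (nhdsWithin_le_of_mem hIcc))] with t ht hst hsub
    refine hsub.eq_tgt fun i hi => nearest_eq_some_true_iff.mpr ?_
    rw [nearest_eq_none_iff] at hi
    have hle : (β s i : ℝ) ≤ β t i := hm hsI ht (le_of_lt hst) i
    exact lt_of_le_of_ne (hi ▸ hle) (hβ i s hsI t ht hst hi).symm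
  · have hsI := Ioc_subset_Icc_self hs
    have hIcc := Icc_mem_nhdsLT_of_mem hs
    filter_upwards [hIcc, self_mem_nhdsWithin, eventually_nearest_isSubface
      ((hc s hsI).mono_left (nhdsWithin_le_of_mem hIcc))] with t ht hts hsub
    refine hsub.eq_src fun i hi => nearest_eq_some_false_iff.mpr ?_
    rw [nearest_eq_none_iff] at hi
    have hle : (β t i : ℝ) ≤ β s i := hm ht hsI (le_of_lt hts) i
    exact lt_of_le_of_ne (hi ▸ hle) fun ht' => hβ i t ht s hsI hts ht' hi

end CubeFace

namespace PrecubicalSet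

variable {X : PrecubicalSet.{u}} {p : I → X.Realization} {a b : I}

namespace Presentation

/-- The presentation of a path on a one point interval. -/
def nil (p : I → X.Realization) (a : I) : X.Presentation p a a where
  len := 0
  time _ := a
  time_mono _ _ _ := le_rfl
  time_zero := rfl
  time_last := rfl
  dim := Fin.elim0
  cube k := k.elim0
  path k := k.elim0
  path_cont k := k.elim0
  path_mono k := k.elim0
  eq_pt k := k.elim0

/-- The extension of a presentation on `[m, b]` by a path `β` in one cube on `[a, m]`. -/
def cons {m : I} (ham : a ≤ m) {n : ℕ} (c : X.cube n) (β : I → Fin n → I)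
    (hc : ContinuousOn β (Icc a m)) (hm : MonotoneOn β (Icc a m))
    (hp : ∀ t ∈ Icc a m, p t = X.pt c (β t)) (P : X.Presentation p m b) :
    X.Presentation p a b where
  len := P.len + 1
  time := Fin.cons a P.time
  time_mono := by
    refine Fin.monotone_iff_le_succ.mpr (Fin.cases ?_ fun k => ?_)
    · exact ham.trans P.time_zero.ge
    · exact P.time_mono (Fin.castSucc_le_succ k)
  time_zero := rfl
  time_last := P.time_last
  dim := Fin.cons n P.dim
  cube := Fin.cases c P.cube
  path := Fin.cases β P.path
  path_cont := Fin.cases (P.time_zero.symm ▸ hc : ContinuousOn β (Icc a (P.time 0))) P.path_cont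
  path_mono := Fin.cases (P.time_zero.symm ▸ hm : MonotoneOn β (Icc a (P.time 0))) P.path_mono
  eq_pt := Fin.cases
    (P.time_zero.symm ▸ hp : ∀ t ∈ Icc a (P.time 0), p t = X.pt c (β t)) P.eq_pt

section cons

variable {m : I} {ham : a ≤ m} {n : ℕ} {c : X.cube n} {β : I → Fin n → I}
  {hc : ContinuousOn β (Icc a m)} {hm : MonotoneOn β (Icc a m)}
  {hp : ∀ t ∈ Icc a m, p t = X.pt c (β t)} {P : X.Presentation p m b}

theorem IsStrict.cons (hP : P.IsStrict)
    (hβ : ∀ i, ∀ s ∈ Icc a m, ∀ t ∈ Icc a m, β s i = β t i → s = t ∨ β s i = 0 ∨ β s i = 1) :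
    (P.cons ham c β hc hm hp).IsStrict :=
  Fin.cases (P.time_zero.symm ▸ hβ) hP

theorem IsTame.cons (hP : P.IsTame) (ha : ∃ v : X.cube 0, p a = X.vertexPt v) :
    (P.cons ham c β hc hm hp).IsTame :=
  Fin.cases ha hP

end cons

theorem rel (P : X.Presentation p a b) {R : I → I → Prop} (hrefl : ∀ s, R s s)
    (htrans : ∀ r s t, R r s → R s t → R r t)
    (h : ∀ k : Fin P.len, R (P.time k.castSucc) (P.time k.succ)) : R a b := by
  suffices ∀ k, R a (P.time k) from P.time_last ▸ this (Fin.last _)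
  refine Fin.induction ?_ fun k hk => htrans _ _ _ hk (h k)
  exact P.time_zero.symm ▸ hrefl a

theorem time_mem (P : X.Presentation p a b) (k : Fin (P.len + 1)) : P.time k ∈ Icc a b :=
  ⟨P.time_zero.ge.trans (P.time_mono (Fin.zero_le _)),
    (P.time_mono (Fin.le_last _)).trans P.time_last.le⟩

theorem le (P : X.Presentation p a b) : a ≤ b := (P.time_mem 0).1.trans (P.time_mem 0).2

theorem Icc_time_subset (P : X.Presentation p a b) (k : Fin P.len) :
    Icc (P.time k.castSucc) (P.time k.succ) ⊆ Icc a b :=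
  Icc_subset_Icc (P.time_mem _).1 (P.time_mem _).2

theorem exists_mem_Icc_time (P : X.Presentation p a b) (hab : a < b) {t : I} (ht : t ∈ Icc a b) :
    ∃ k : Fin P.len, t ∈ Icc (P.time k.castSucc) (P.time k.succ) := by
  let R (r s : I) : Prop := r = s ∨
    (t ∈ Icc r s → ∃ k : Fin P.len, t ∈ Icc (P.time k.castSucc) (P.time k.succ))
  have hR : R a b := by
    refine P.rel (fun _ => .inl rfl) ?_ fun k => .inr fun h => ⟨k, h⟩
    rintro r s u (rfl | hrs) (rfl | hsu)
    · exact .inl rfl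
    · exact .inr hsu
    · exact .inr hrs
    · exact .inr fun h =>
        (le_total t s).elim (fun hts => hrs ⟨h.1, hts⟩) fun hst => hsu ⟨hst, h.2⟩
  exact hR.resolve_left hab.ne ht

theorem restrict (P : X.Presentation p a b) {a' b' : I} (ha : a ≤ a') (hab : a' ≤ b')
    (hb : b' ≤ b) : Nonempty (X.Presentation p a' b') := by
  suffices ∀ k, ∀ s, P.time k ≤ s → s ≤ b' → Nonempty (X.Presentation p s b') from
    this 0 a' (P.time_zero.le.trans ha) hab
  refine Fin.reverseInduction (fun s hs hsb => ?_) fun k ih s hs hsb => ?_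
  · obtain rfl : s = b' := le_antisymm hsb (hb.trans (P.time_last ▸ hs))
    exact ⟨nil p s⟩
  have extend {m : I} (hsm : s ≤ m) (hm : m ≤ P.time k.succ) (Q : X.Presentation p m b') :
      X.Presentation p s b' :=
    have hsub : Icc s m ⊆ Icc (P.time k.castSucc) (P.time k.succ) := Icc_subset_Icc hs hm
    Q.cons hsm (P.cube k) (P.path k) ((P.path_cont k).mono hsub) ((P.path_mono k).mono hsub)
      fun t ht => P.eq_pt k t (hsub ht)
  rcases le_total (P.time k.succ) s with hks | hsk
  · exact ih s hks hsb
  rcases le_total b' (P.time k.succ) with hbk | hkb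
  · exact ⟨extend hsb hbk (nil p b')⟩
  · exact (ih _ le_rfl hkb).map (extend hsk le_rfl)

end Presentation

end PrecubicalSet

namespace PrecubicalSet

variable {X : PrecubicalSet.{u}} {p : I → X.Realization} {a b : I} {e : X.Cell} {ts : List I}

/-- The smallest cube whose collar contains the point `p t`; this is `ρ(p(t))` in the paper. -/
noncomputable def trace (p : I → X.Realization) (t : I) : X.Cell := X.nearestFace (p t)

theorem nearestFace_pt {n : ℕ} (c : X.cube n) (x : Fin n → I) :
    X.nearestFace (X.pt c x) = X.iterFace (CubeFace.nearest x) c := rfl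

theorem trace_of_eq_vertexPt {t : I} {v : X.cube 0} (h : p t = X.vertexPt v) :
    trace p t = ⟨0, v⟩ :=
  congrArg X.nearestFace h

namespace Presentation

theorem trace_eq (P : X.Presentation p a b) {k : Fin P.len} {t : I}
    (ht : t ∈ Icc (P.time k.castSucc) (P.time k.succ)) :
    trace p t = X.iterFace (CubeFace.nearest (P.path k t)) (P.cube k) := by
  rw [trace, P.eq_pt k t ht, nearestFace_pt]

theorem IsStrict.stepOn_trace {P : X.Presentation p a b} (hP : P.IsStrict) :
    StepOn (trace p) a b := by
  refine P.rel (StepOn.refl _) (fun _ _ _ => StepOn.trans) fun k => ?_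
  refine (CubeFace.stepOn_nearest (P.path_cont k) (P.path_mono k) ?_).map
    (preservesEnds_iterFace (P.cube k)) fun t ht => P.trace_eq ht
  intro i s hs t ht hst hsi hti
  rcases hP k i s hs t ht (Subtype.ext (hsi.trans hti.symm)) with h | h | h
  · exact hst.ne h
  · norm_num [h] at hsi
  · norm_num [h] at hsi

/-- A coordinate that rests at `1/2` would keep the trace away from the vertices for a while. -/
theorem stepOn_nearest (P : X.Presentation p a b) (h : StepOn (trace p) a b) (k : Fin P.len) :
    StepOn (fun t => CubeFace.nearest (P.path k t)) (P.time k.castSucc) (P.time k.succ) := by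
  refine CubeFace.stepOn_nearest (P.path_cont k) (P.path_mono k) fun i s hs t ht hst hsi hti => ?_
  have := nhdsGT_neBot_of_exists_gt ⟨t, hst⟩
  have hlt : s < b := hst.trans_le (P.Icc_time_subset k ht).2
  obtain ⟨r, hr, hsr, hrt⟩ :=
    ((h.1 s ⟨(P.Icc_time_subset k hs).1, hlt⟩).and (Ioo_mem_nhdsGT hst)).exists
  have hrk : r ∈ Icc (P.time k.castSucc) (P.time k.succ) := ⟨hs.1.trans hsr.le, hrt.le.trans ht.2⟩
  have hri : (P.path k r i : ℝ) = 1 / 2 :=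
    le_antisymm (hti ▸ P.path_mono k hrk ht hrt.le i) (hsi ▸ P.path_mono k hs hrk hsr.le i)
  have hvertex : IsVertex (trace p r) := hr ▸ isVertex_tgt _
  rw [P.trace_eq hrk, isVertex_iterFace_iff, CubeFace.isVertex_iff] at hvertex
  exact hvertex i (CubeFace.nearest_eq_none_iff.mpr hri)

/-- The local condition on the faces `F t` in the definition of `RunsInCollar`. -/
def IsCollarLift (P : X.Presentation p a b) (e : X.Cell) (F : I → CubeFace e.1) : Prop :=
  ∀ (k : Fin P.len), ∀ s ∈ Icc (P.time k.castSucc) (P.time k.succ),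
    ∃ (J : CubeFace (P.dim k)) (K : CubeFace e.1)
      (φ : {j : Fin (P.dim k) // J j = none} ≃o {i : Fin e.1 // K i = none}),
      X.iterFace J (P.cube k) = X.iterFace K e.2 ∧
      ∀ᶠ t in 𝓝[Icc (P.time k.castSucc) (P.time k.succ)] s,
        P.path k t ∈ CubeFace.collar J ∧
          F t = CubeFace.transfer J K φ (CubeFace.nearest (P.path k t))

variable {P : X.Presentation p a b} {F : I → CubeFace e.1}

theorem IsCollarLift.trace_eq (h : P.IsCollarLift e F) (hab : a < b) {t : I} (ht : t ∈ Icc a b) :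
    trace p t = X.iterFace (F t) e.2 := by
  obtain ⟨k, hk⟩ := P.exists_mem_Icc_time hab ht
  obtain ⟨J, K, φ, hJK, hev⟩ := h k t hk
  obtain ⟨hJ, hF⟩ := hev.self_of_nhdsWithin hk
  rw [hF, iterFace_transfer φ hJK (CubeFace.mem_collar_iff.mp hJ), P.trace_eq hk]

theorem IsCollarLift.stepOn (h : P.IsCollarLift e F) (hp : StepOn (trace p) a b) :
    StepOn F a b := by
  refine P.rel (StepOn.refl _) (fun _ _ _ => StepOn.trans) fun k => ?_
  refine (P.stepOn_nearest hp k).of_eventually_map fun s hs => ?_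
  obtain ⟨J, K, φ, -, hev⟩ := h k s hs
  exact ⟨_, CubeFace.preservesEnds_transfer φ, hev.mono fun t ht => ht.2⟩

theorem isCollarLift_of_stepOn (P : X.Presentation p a b) (hp : StepOn (trace p) a b)
    (hF : StepOn F a b) (htrace : ∀ t ∈ Icc a b, trace p t = X.iterFace (F t) e.2) :
    P.IsCollarLift e F := by
  intro k s hs
  have hJK : X.iterFace (CubeFace.nearest (P.path k s)) (P.cube k) = X.iterFace (F s) e.2 :=
    (P.trace_eq hs).symm.trans (htrace s (P.Icc_time_subset k hs))
  obtain ⟨φ⟩ := exists_orderIso_of_iterFace_eq hJK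
  have hcollar := CubeFace.eventually_nearest_isSubface (P.path_cont k s hs)
  have hnearest := P.stepOn_nearest hp k
  have hFk := hF.mono (P.time_mem k.castSucc).1 (P.time_mem k.succ).2
  have hFs : CubeFace.transfer _ _ φ (CubeFace.nearest (P.path k s)) = F s :=
    CubeFace.transfer_self φ
  have hφ := CubeFace.preservesEnds_transfer φ
  refine ⟨_, _, φ, hJK, (hcollar.mono fun t => CubeFace.mem_collar_iff.mpr).and
    (eventually_nhdsWithin_Icc hFs.symm (fun hlt => ?_) fun hlt => ?_)⟩
  · filter_upwards [hnearest.2 s ⟨hlt, hs.2⟩, hFk.2 s ⟨hlt, hs.2⟩] with t ht htF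
    rw [htF, ht, hφ.map_src, hFs]
  · filter_upwards [hnearest.1 s ⟨hs.1, hlt⟩, hFk.1 s ⟨hs.1, hlt⟩] with t ht htF
    rw [htF, ht, hφ.map_tgt, hFs]

end Presentation

theorem RunsInCollar.lt (h : X.RunsInCollar p e a b) (he : 0 < e.1) : a < b := by
  obtain ⟨P, F, hFa, hFb, -⟩ := h
  refine P.le.lt_of_ne ?_
  rintro rfl
  simpa [CubeFace.corner] using congrFun (hFa.symm.trans hFb) ⟨0, he⟩

theorem RunsInCollar.exists_isCrossingSeq (h : X.RunsInCollar p e a b)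
    (hp : StepOn (trace p) a b) :
    ∃ ts, IsCrossingSeq (trace p) a ts b ∧ RefinesCell e (ts.map (trace p)) := by
  have hlt := h.lt
  obtain ⟨P, F, hFa, hFb, hF⟩ := h
  have hlift : P.IsCollarLift e F := hF
  rcases P.le.eq_or_lt with rfl | hab
  · exact ⟨[], .refl _ a, refinesCell_nil_iff.mpr (Nat.eq_zero_of_not_pos fun he => (hlt he).false)⟩
  obtain ⟨ts, hts⟩ := (hlift.stepOn hp).exists_isCrossingSeq hab.le
  have htrace : ∀ t ∈ Icc a b, trace p t = X.iterFace (F t) e.2 := fun _ => hlift.trace_eq hab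
  refine ⟨ts, hts.map (preservesEnds_iterFace e.2) (fun _ => isVertex_iterFace_iff.mp) htrace,
    ts.map F, ?_, ?_⟩
  · have hchain := hts.chain (hFb ▸ isVertex_tgt (fun _ => none))
    rwa [hFa, hFb] at hchain
  · rw [List.map_map]
    exact List.map_congr_left fun t ht =>
      (htrace t (Ioc_subset_Icc_self (hts.mem_iff.mp ht).1)).symm

theorem Presentation.runsInCollar_of_isCrossingSeq (P : X.Presentation p a b)
    (hts : IsCrossingSeq (trace p) a ts b) (ha : trace p a = src e) (hb : IsVertex (trace p b))
    (he : RefinesCell e (ts.map (trace p))) : X.RunsInCollar p e a b := by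
  obtain ⟨L, hL, hmap⟩ := he
  obtain ⟨F, hFa, hFb, hF, htrace⟩ := hts.exists_lift (preservesEnds_iterFace e.2)
    (u := CubeFace.corner e.1 false) (ha.trans (iterFace_corner false e.2).symm) hL hmap
  have hvertex : IsVertex (F b) :=
    isVertex_iterFace_iff.mp (htrace b (right_mem_Icc.mpr hts.le) ▸ hb)
  exact ⟨P, F, hFa, hvertex.tgt_eq.symm.trans hFb,
    P.isCollarLift_of_stepOn (hts.stepOn hb) (hF.stepOn hvertex) htrace⟩

theorem exists_isCrossingSeq_of_concatenates {es : List X.Cell}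
    (h : Concatenates (X.RunsInCollar p) es a b) (hp : StepOn (trace p) a b) :
    ∃ ts, IsCrossingSeq (trace p) a ts b ∧ RefinesList es (ts.map (trace p)) := by
  induction es generalizing a with
  | nil => exact ⟨[], h ▸ .refl _ a, rfl⟩
  | cons e es ih =>
    obtain ⟨m, ham, hmb, he, hes⟩ := h
    obtain ⟨ts, hts, hets⟩ := he.exists_isCrossingSeq (hp.mono le_rfl hmb)
    obtain ⟨ts', hts', hets'⟩ := ih hes (hp.mono ham le_rfl)
    exact ⟨ts ++ ts', hts.append hts', _, _, List.map_append, hets, hets'⟩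

theorem Presentation.concatenates_of_isCrossingSeq {es : List X.Cell} {w : X.Cell}
    (P : X.Presentation p a b) (hes : Chain (tgt e) es w) (hts : IsCrossingSeq (trace p) a ts b)
    (ha : trace p a = src e) (hb : IsVertex (trace p b))
    (h : RefinesList (e :: es) (ts.map (trace p))) :
    Concatenates (X.RunsInCollar p) (e :: es) a b := by
  induction es generalizing a e ts with
  | nil =>
    rw [refinesList_singleton_iff] at h
    exact ⟨b, hts.le, le_rfl, P.runsInCollar_of_isCrossingSeq hts ha hb h, rfl⟩
  | cons e' es ih =>
    obtain ⟨_, _, heq, he, h⟩ := h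
    obtain ⟨ts₁, ts₂, rfl, rfl, rfl⟩ := List.map_eq_append_iff.mp heq
    obtain ⟨m, hm, hts₁, hts₂⟩ := hts.exists_cut hb
    obtain ⟨P₁⟩ := P.restrict le_rfl hts₁.le hts₂.le
    obtain ⟨P₂⟩ := P.restrict hts₁.le hts₂.le le_rfl
    have hchain : Chain (src e) (ts₁.map (trace p)) (trace p m) :=
      (isVertex_src e).tgt_eq ▸ ha ▸ hts₁.chain hm
    have hme : trace p m = src e' := (hchain.unique_right he.chain).trans hes.2.1.symm
    exact ⟨m, hts₁.le, hts₂.le, P₁.runsInCollar_of_isCrossingSeq hts₁ ha hm he,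
      ih P₂ hes.2.2 hts₂ hme h⟩

theorem crossingCubes_eq (h : IsCrossingSeq (trace p) 0 ts 1) (h₀ : IsVertex (trace p 0)) :
    X.crossingCubes p = ts.map (trace p) := by
  classical
  have hset : X.crossingTimes p = (ts.toFinset : Set I) := by
    ext t
    rw [List.coe_toFinset, mem_ofPred_eq, h.mem_iff]
    refine not_isVertex_iff.symm.trans (iff_and_self.mpr fun ht => ⟨?_, le_top⟩)
    exact lt_of_le_of_ne bot_le fun h0t => ht (h0t ▸ h₀)
  have hfin : (X.crossingTimes p).Finite := hset ▸ ts.toFinset.finite_toSet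
  have hts : hfin.toFinset = ts.toFinset := by
    rw [← Finset.coe_inj, Finite.coe_toFinset, hset]
  have hsorted : (ts.toFinset.sort (· ≤ ·)) = ts :=
    (List.toFinset_sort _ h.sortedLT.nodup).mpr h.sortedLT.sortedLE.pairwise
  rw [crossingCubes, dif_pos hfin, hts, hsorted]
  rfl

section Chains

variable {x y : X.cube 0}

namespace CubeChain

theorem refinesList_pieces_iff (c : X.CubeChain x y) {l : List X.Cell} :
    RefinesList c.pieces l ↔ RefinesList c.cubes l := by
  unfold pieces
  split
  next h => rw [h, refinesList_cons_iff_of_dim_eq_zero rfl]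
  next h => rw [h]

theorem exists_pieces_eq_cons (c : X.CubeChain x y) :
    ∃ e es, c.pieces = e :: es ∧ src e = ⟨0, x⟩ ∧ Chain (tgt e) es ⟨0, y⟩ := by
  have hchain := c.chain
  unfold pieces
  split
  next h => exact ⟨_, _, rfl, rfl, h ▸ hchain⟩
  next h =>
    rw [h] at hchain
    exact ⟨_, _, rfl, hchain.2⟩

end CubeChain

variable {p : C(I, X.Realization)}

theorem exists_isCrossingSeq_of_mem_strictPaths (hp : p ∈ X.strictPaths x y) :
    ∃ ts, IsCrossingSeq (trace p) 0 ts 1 ∧ X.crossingCubes p = ts.map (trace p) := by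
  obtain ⟨P, hP⟩ := hp.2
  obtain ⟨ts, hts⟩ := hP.stepOn_trace.exists_isCrossingSeq zero_le_one
  exact ⟨ts, hts, crossingCubes_eq hts (trace_of_eq_vertexPt hp.1.1 ▸ rfl)⟩

theorem exists_cubes_eq_crossingCubes (hp : p ∈ X.strictPaths x y) :
    ∃ cp : X.CubeChain x y, cp.cubes = X.crossingCubes p := by
  obtain ⟨ts, hts, heq⟩ := exists_isCrossingSeq_of_mem_strictPaths hp
  have h₁ : trace p 1 = ⟨0, y⟩ := trace_of_eq_vertexPt hp.1.2.1
  have hchain := hts.chain (h₁ ▸ rfl)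
  rw [trace_of_eq_vertexPt hp.1.1, h₁] at hchain
  exact heq ▸ CubeChain.exists_of_chain hchain

theorem mem_collarPaths_iff (hp : p ∈ X.strictPaths x y) {c : X.CubeChain x y} :
    p ∈ X.collarPaths c ↔ RefinesList c.cubes (X.crossingCubes p) := by
  have h₀ : trace p 0 = ⟨0, x⟩ := trace_of_eq_vertexPt hp.1.1
  have h₁ : IsVertex (trace p 1) := trace_of_eq_vertexPt hp.1.2.1 ▸ rfl
  rw [← c.refinesList_pieces_iff]
  constructor
  · rintro ⟨-, h⟩
    obtain ⟨P, hP⟩ := hp.2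
    obtain ⟨ts, hts, hcts⟩ := exists_isCrossingSeq_of_concatenates h hP.stepOn_trace
    rwa [crossingCubes_eq hts (h₀ ▸ rfl)]
  · intro h
    obtain ⟨ts, hts, heq⟩ := exists_isCrossingSeq_of_mem_strictPaths hp
    obtain ⟨P⟩ := hp.1.2.2
    obtain ⟨e, es, hc, he, hes⟩ := c.exists_pieces_eq_cons
    rw [heq, hc] at h
    exact ⟨hp.1, hc ▸ P.concatenates_of_isCrossingSeq hes hts (h₀.trans he.symm) h₁ h⟩

end Chains

end PrecubicalSet

theorem exists_continuous_strictMonoOn_Icc {a b : I} (hab : a < b) :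
    ∃ d : I → I, Continuous d ∧ StrictMonoOn d (Icc a b) ∧ d a = 0 ∧ d b = 1 := by
  have hab' : (0 : ℝ) < b - a := sub_pos.mpr hab
  refine ⟨fun t => projIcc 0 1 zero_le_one (((t : ℝ) - a) / (b - a)), by fun_prop, ?_, by simp, ?_⟩
  · have hmem : ∀ t ∈ Icc a b, ((t : ℝ) - a) / (b - a) ∈ Icc (0 : ℝ) 1 := fun t ht =>
      ⟨div_nonneg (sub_nonneg.mpr ht.1) hab'.le,
        (div_le_one hab').mpr (sub_le_sub_right (Subtype.coe_le_coe.mpr ht.2) _)⟩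
    exact fun s hs t ht hst => strictMonoOn_projIcc _ (hmem s hs) (hmem t ht)
      (div_lt_div_of_pos_right (sub_lt_sub_right (Subtype.coe_lt_coe.mpr hst) _) hab')
  · simp [div_self hab'.ne']

theorem CubeFace.exists_isCrossingSeq_diagonal {n : ℕ} (hn : 0 < n) {d : I → I} {a b : I}
    (hab : a ≤ b) (hd : ContinuousOn d (Icc a b)) (hmono : StrictMonoOn d (Icc a b))
    (ha : d a = 0) (hb : d b = 1) :
    ∃ r, nearest (fun _ : Fin n => d r) = (fun _ => none) ∧
      IsCrossingSeq (fun t => nearest fun _ : Fin n => d t) a [r] b := by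
  obtain ⟨r, hr, hdr⟩ : (⟨1 / 2, by norm_num, by norm_num⟩ : I) ∈ d '' Icc a b :=
    intermediate_value_Icc hab hd (by rw [ha, hb]; exact ⟨bot_le, le_top⟩)
  have hhalf : (d r : ℝ) = 1 / 2 := congrArg Subtype.val hdr
  have hnone : nearest (fun _ : Fin n => d r) = (fun _ => none) :=
    funext fun _ => nearest_eq_none_iff.mpr hhalf
  have hlt {t : I} (ht : t ∈ Icc a b) (htr : t < r) :
      nearest (fun _ : Fin n => d t) = fun _ => some false :=
    funext fun _ => nearest_eq_some_false_iff.mpr (hhalf ▸ hmono ht hr htr)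
  have hgt {t : I} (ht : t ∈ Icc a b) (hrt : r < t) :
      nearest (fun _ : Fin n => d t) = fun _ => some true :=
    funext fun _ => nearest_eq_some_true_iff.mpr (hhalf ▸ hmono hr ht hrt)
  have har : a < r := hr.1.lt_of_ne (by rintro rfl; norm_num [ha] at hhalf)
  have htgt : tgt (nearest fun _ : Fin n => d a) = fun _ => some false := by
    rw [hlt (left_mem_Icc.mpr hab) har]
    rfl
  refine ⟨r, hnone, har, ?_, fun t ht => ?_, ?_, hr.2, fun t ht => ?_⟩
  · simp only [hnone, isVertex_iff]
    exact fun h => h ⟨0, hn⟩ rfl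
  · simp only [htgt]
    exact hlt ⟨ht.1.le, ht.2.le.trans hr.2⟩ ht.2
  · simp only [htgt, hnone]
    rfl
  · simp only [hnone]
    exact hgt ⟨hr.1.trans ht.1.le, ht.2⟩ ht.1

namespace PrecubicalSet

variable {X : PrecubicalSet.{u}}

theorem continuous_pt {n : ℕ} (c : X.cube n) : Continuous (X.pt c) :=
  continuous_quot_mk.comp (@continuous_sigmaMk X.Cell (fun c => Fin c.1 → I) _ ⟨n, c⟩)

theorem pt_const_eq_vertexPt (α : Bool) {n : ℕ} (c : X.cube n) :
    X.pt c (fun _ => if α then 1 else 0) = X.vertexPt (X.endVertex α c) := by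
  induction n with
  | zero => exact congrArg (X.pt c) (Subsingleton.elim _ _)
  | succ n ih =>
    have hglue := Quot.sound (Glue.glue c 0 α fun _ => if α then 1 else 0)
    refine Eq.trans (congrArg (X.pt c) (funext ?_)) (hglue.symm.trans (ih (X.face α 0 c)))
    exact Fin.cases (by simp) (by simp)

namespace Presentation

variable {p q : I → X.Realization} {a b : I}

/-- The same presentation for a path that agrees with `p` on the interval. -/
def congr (P : X.Presentation p a b) (h : ∀ t ∈ Icc a b, q t = p t) : X.Presentation q a b where
  __ := P
  eq_pt k t ht := (h t (P.Icc_time_subset k ht)).trans (P.eq_pt k t ht)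

theorem IsTame.congr {P : X.Presentation p a b} (hP : P.IsTame) (h : ∀ t ∈ Icc a b, q t = p t) :
    (P.congr h).IsTame := fun k =>
  (hP k).imp fun _ => (h _ (P.time_mem k)).trans

end Presentation

/-- `p` is continuous, strict and tame on `[a, b]`, and crosses the cubes of the list `l` there. -/
structure CrossesStrictTame (p : I → X.Realization) (l : List X.Cell) (a b : I) : Prop where
  continuous : Continuous p
  presentation : ∃ P : X.Presentation p a b, P.IsStrict ∧ P.IsTame
  crossing : ∃ ts, IsCrossingSeq (trace p) a ts b ∧ ts.map (trace p) = l

theorem crossesStrictTame_const (x : X.cube 0) {a b : I} (hab : a ≤ b) :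
    CrossesStrictTame (fun _ => X.vertexPt x) [] a b where
  continuous := continuous_const
  presentation :=
    ⟨(Presentation.nil _ b).cons hab x (fun _ => Fin.elim0) continuousOn_const monotoneOn_const
      fun _ _ => rfl, .cons (fun k => k.elim0) fun i => i.elim0, .cons (fun _ => ⟨x, rfl⟩) ⟨x, rfl⟩⟩
  crossing := ⟨[], ⟨hab, fun _ _ => rfl⟩, rfl⟩

theorem CrossesStrictTame.exists_cons {e : X.Cell} (he : 0 < e.1) {q : I → X.Realization}
    {l : List X.Cell} {a m b : I} (hq : CrossesStrictTame q l m b) (ham : a < m)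
    (hmb : m ≤ b) (hqm : q m = X.vertexPt (X.endVertex true e.2)) :
    ∃ p, p a = X.vertexPt (X.endVertex false e.2) ∧ p b = q b ∧
      CrossesStrictTame p (e :: l) a b := by
  obtain ⟨d, hd, hmono, hda, hdm⟩ := exists_continuous_strictMonoOn_Icc ham
  have hdiag : Continuous fun t => X.pt e.2 fun _ => d t := (continuous_pt e.2).comp (by fun_prop)
  have hglue : X.pt e.2 (fun _ => d m) = q m := by
    rw [hqm, hdm]
    exact pt_const_eq_vertexPt true e.2
  set p : I → X.Realization := fun t => if t ≤ m then X.pt e.2 (fun _ => d t) else q t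
  have hp : ∀ t ∈ Icc a m, p t = X.pt e.2 fun _ => d t := fun t ht => if_pos ht.2
  have hpq : ∀ t ∈ Icc m b, p t = q t := fun t ht => by
    rcases ht.1.eq_or_lt with rfl | hmt
    · exact (hp m (right_mem_Icc.mpr ham.le)).trans hglue
    · exact if_neg hmt.not_ge
  have hpa : p a = X.vertexPt (X.endVertex false e.2) := by
    rw [hp a (left_mem_Icc.mpr ham.le), hda]
    exact pt_const_eq_vertexPt false e.2
  refine ⟨p, hpa, hpq b (right_mem_Icc.mpr hmb), ?_, ?_, ?_⟩
  · exact hdiag.if_le hq.continuous continuous_id continuous_const (by rintro t rfl; exact hglue)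
  · obtain ⟨Q, hstrict, htame⟩ := hq.presentation
    refine ⟨(Q.congr hpq).cons ham.le e.2 (fun t _ => d t) (by fun_prop)
      (fun s hs t ht hst _ => hmono.monotoneOn hs ht hst) hp, ?_, ?_⟩
    · exact .cons hstrict fun _ s hs t ht h => .inl (hmono.injOn hs ht h)
    · exact (htame.congr hpq).cons ⟨_, hpa⟩
  · obtain ⟨ts, hts, rfl⟩ := hq.crossing
    obtain ⟨r, hr, hcross⟩ :=
      CubeFace.exists_isCrossingSeq_diagonal he ham.le hd.continuousOn hmono hda hdm
    have htrace : ∀ t ∈ Icc a m, trace p t = X.iterFace (CubeFace.nearest fun _ => d t) e.2 :=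
      fun t ht => congrArg X.nearestFace (hp t ht)
    have htrace' : ∀ t ∈ Icc m b, trace p t = trace q t :=
      fun t ht => congrArg X.nearestFace (hpq t ht)
    have hdiagonal : IsCrossingSeq (trace p) a [r] m :=
      hcross.map (preservesEnds_iterFace e.2) (fun _ => isVertex_iterFace_iff.mp) htrace
    refine ⟨r :: ts, hdiagonal.append (hts.congr htrace'), List.cons_eq_cons.mpr ⟨?_, ?_⟩⟩
    · rw [htrace r ⟨hcross.1.le, hcross.2.2.2.2.1⟩, hr, iterFace_none]
    · exact List.map_congr_left fun t ht =>
        htrace' t (Ioc_subset_Icc_self (hts.mem_iff.mp ht).1)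

theorem exists_crossesStrictTame {x y : X.cube 0} {l : List X.Cell}
    (h : Chain (⟨0, x⟩ : X.Cell) l ⟨0, y⟩) {a b : I} (hab : a < b) :
    ∃ p, p a = X.vertexPt x ∧ p b = X.vertexPt y ∧ CrossesStrictTame p l a b := by
  induction l generalizing x a with
  | nil =>
    obtain rfl : x = y := sigma_mk_injective (Chain.nil_iff.mp h)
    exact ⟨_, rfl, rfl, crossesStrictTame_const x hab.le⟩
  | cons e l ih =>
    obtain ⟨he, hsrc, hl⟩ := h
    obtain rfl : X.endVertex false e.2 = x := sigma_mk_injective hsrc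
    obtain ⟨m, ham, hmb⟩ := exists_between hab
    obtain ⟨q, hqm, hqb, hq⟩ := ih (x := X.endVertex true e.2) hl hmb
    rw [← hqb]
    exact hq.exists_cons (not_isVertex_iff.mp he) ham hmb.le hqm

theorem exists_mem_strictTamePaths {x y : X.cube 0} (c : X.CubeChain x y) :
    ∃ p ∈ X.strictTamePaths x y, X.crossingCubes p = c.cubes := by
  obtain ⟨p, h₀, h₁, hp⟩ := exists_crossesStrictTame c.chain (zero_lt_one (α := I))
  obtain ⟨P, hstrict, htame⟩ := hp.presentation
  obtain ⟨ts, hts, hcubes⟩ := hp.crossing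
  exact ⟨⟨p, hp.continuous⟩, ⟨⟨⟨h₀, h₁, ⟨P⟩⟩, P, hstrict⟩, ⟨h₀, h₁, ⟨P⟩⟩, P, htame⟩,
    (crossingCubes_eq hts (trace_of_eq_vertexPt h₀ ▸ rfl)).trans hcubes⟩

end PrecubicalSet

namespace PrecubicalSet

variable {X : PrecubicalSet.{u}} {e : X.Cell}

theorem mem_collar_iff {z : X.Realization} :
    z ∈ X.collar e ↔ ∃ K : CubeFace e.1, X.nearestFace z = X.iterFace K e.2 := by
  constructor
  · rintro ⟨n, c, J, x, rfl, hx, K, hJK⟩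
    obtain ⟨φ⟩ := exists_orderIso_of_iterFace_eq hJK
    exact ⟨_, (iterFace_transfer φ hJK (CubeFace.mem_collar_iff.mp hx)).symm⟩
  · induction z using Quot.ind with
    | mk z =>
      rintro ⟨K, hK⟩
      exact ⟨z.1.1, z.1.2, CubeFace.nearest z.2, z.2, rfl, CubeFace.mem_collar_iff.mpr (.refl _),
        K, hK⟩

theorem mem_star_iff {v : X.cube 0} {z : X.Realization} :
    z ∈ X.star v ↔ X.nearestFace z = ⟨0, v⟩ :=
  mem_collar_iff.trans ⟨fun ⟨_, h⟩ => h, fun h => ⟨Fin.elim0, h⟩⟩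

section Intervals

variable {p : I → X.Realization} {a b : I}

theorem RunsInCollar.staysInCollar (h : X.RunsInCollar p e a b) (hab : a < b) :
    X.StaysInCollar p e a b := by
  obtain ⟨P, F, hFa, hFb, hF⟩ := h
  have htrace : ∀ t ∈ Icc a b, trace p t = X.iterFace (F t) e.2 :=
    fun _ => Presentation.IsCollarLift.trace_eq (P := P) hF hab
  refine ⟨fun t ht => mem_collar_iff.mpr ⟨F t, htrace t ht⟩, mem_star_iff.mpr ?_,
    mem_star_iff.mpr ?_⟩
  · rw [← iterFace_corner, ← hFa]
    exact htrace a (left_mem_Icc.mpr hab.le)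
  · rw [← iterFace_corner, ← hFb]
    exact htrace b (right_mem_Icc.mpr hab.le)

theorem Presentation.exists_eventually_eq_transfer (P : X.Presentation p a b) {k : Fin P.len}
    {s : I} (hs : s ∈ Icc (P.time k.castSucc) (P.time k.succ)) {K : CubeFace e.1}
    (hK : trace p s = X.iterFace K e.2) :
    ∃ φ : {j // CubeFace.nearest (P.path k s) j = none} ≃o {i // K i = none},
      X.iterFace (CubeFace.nearest (P.path k s)) (P.cube k) = X.iterFace K e.2 ∧
      ∀ᶠ t in 𝓝[Icc (P.time k.castSucc) (P.time k.succ)] s,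
        P.path k t ∈ CubeFace.collar (CubeFace.nearest (P.path k s)) ∧
        trace p t =
          X.iterFace (CubeFace.transfer _ K φ (CubeFace.nearest (P.path k t))) e.2 := by
  rw [P.trace_eq hs] at hK
  obtain ⟨φ⟩ := exists_orderIso_of_iterFace_eq hK
  refine ⟨φ, hK, ?_⟩
  filter_upwards [CubeFace.eventually_nearest_isSubface (P.path_cont k s hs),
    self_mem_nhdsWithin] with t hsub ht
  exact ⟨CubeFace.mem_collar_iff.mpr hsub, by rw [P.trace_eq ht, iterFace_transfer φ hK hsub]⟩

theorem StaysInCollar.runsInCollar (hX : X.NonSelfLinked) (h : X.StaysInCollar p e a b)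
    (P : X.Presentation p a b) : X.RunsInCollar p e a b := by
  obtain ⟨hcollar, ha, hb⟩ := h
  choose! F hF using fun t ht => mem_collar_iff.mp (hcollar t ht)
  have huniq : ∀ t ∈ Icc a b, ∀ K : CubeFace e.1, trace p t = X.iterFace K e.2 → F t = K :=
    fun t ht K hK => hX e.1 e.2 ((hF t ht).symm.trans hK)
  refine ⟨P, F, huniq a (left_mem_Icc.mpr P.le) _ ?_, huniq b (right_mem_Icc.mpr P.le) _ ?_,
    fun k s hs => ?_⟩
  · rw [iterFace_corner]
    exact mem_star_iff.mp ha
  · rw [iterFace_corner]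
    exact mem_star_iff.mp hb
  · obtain ⟨φ, hJK, hev⟩ :=
      P.exists_eventually_eq_transfer hs (hF s (P.Icc_time_subset k hs))
    refine ⟨_, _, φ, hJK, ?_⟩
    filter_upwards [hev, self_mem_nhdsWithin] with t ht htk
    exact ⟨ht.1, huniq t (P.Icc_time_subset k htk) _ ht.2⟩

theorem Concatenates.imp {Q Q' : X.Cell → I → I → Prop} {es : List X.Cell}
    (h : Concatenates Q es a b) (hQ : ∀ e ∈ es, ∀ s t, s ≤ t → Q e s t → Q' e s t) :
    Concatenates Q' es a b := by
  induction es generalizing a with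
  | nil => exact h
  | cons e es ih =>
    obtain ⟨m, ham, hmb, he, hes⟩ := h
    exact ⟨m, ham, hmb, hQ e List.mem_cons_self a m ham he,
      ih hes fun e' he' => hQ e' (List.mem_cons_of_mem e he')⟩

end Intervals

variable {x y : X.cube 0}

theorem collarPaths_subset_plainCollarPaths (c : X.CubeChain x y) :
    X.collarPaths c ⊆ X.plainCollarPaths c := by
  refine fun p hp => ⟨hp.1, ?_⟩
  have h := hp.2
  by_cases hc : c.cubes = []
  · have hpieces : c.pieces = [⟨0, x⟩] := by simp only [CubeChain.pieces, hc]
    rw [hpieces] at h ⊢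
    obtain ⟨m, h0, h1, hm, rfl⟩ := h
    exact ⟨1, h0, h1, hm.staysInCollar zero_lt_one, rfl⟩
  · have hpieces : c.pieces = c.cubes := by
      unfold CubeChain.pieces
      split <;> simp_all only [not_true_eq_false]
    rw [hpieces] at h ⊢
    exact h.imp fun e he s t _ hQ => hQ.staysInCollar (hQ.lt (c.dim_pos e he))

theorem NonSelfLinked.collarPaths_eq (hX : X.NonSelfLinked) (c : X.CubeChain x y) :
    X.collarPaths c = X.plainCollarPaths c := by
  refine (collarPaths_subset_plainCollarPaths c).antisymm fun p hp => ⟨hp.1, ?_⟩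
  obtain ⟨P⟩ := hp.1.2.2
  refine hp.2.imp fun e _ s t hst hQ => ?_
  obtain ⟨Q⟩ := P.restrict bot_le hst le_top
  exact hQ.runsInCollar hX Q

variable {p : C(I, X.Realization)} {c c' d : X.CubeChain x y}

theorem mem_collarPaths_iff_refines (hp : p ∈ X.strictPaths x y)
    (hd : d.cubes = X.crossingCubes p) : p ∈ X.collarPaths c ↔ d.Refines c := by
  rw [mem_collarPaths_iff hp, CubeChain.refines_iff, hd]

theorem exists_finest_cubeChain (hp : p ∈ X.strictPaths x y) :
    ∃ cp : X.CubeChain x y, cp.cubes = X.crossingCubes p ∧ p ∈ X.collarPaths cp ∧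
      ∀ c : X.CubeChain x y, p ∈ X.collarPaths c → cp.Refines c := by
  obtain ⟨cp, hcp⟩ := exists_cubes_eq_crossingCubes hp
  exact ⟨cp, hcp, (mem_collarPaths_iff_refines hp hcp).mpr .refl,
    fun _ => (mem_collarPaths_iff_refines hp hcp).mp⟩

theorem CubeChain.exists_mem_strictTamePaths_forall_mem_collarPaths_iff (d : X.CubeChain x y) :
    ∃ p ∈ X.strictTamePaths x y, ∀ c : X.CubeChain x y, p ∈ X.collarPaths c ↔ d.Refines c := by
  obtain ⟨p, hp, hcubes⟩ := exists_mem_strictTamePaths d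
  exact ⟨p, hp, fun _ => mem_collarPaths_iff_refines hp.1 hcubes.symm⟩

namespace CubeChain

variable {A : Set C(I, X.Realization)}

theorem Refines.inter_collarPaths_subset (h : c'.Refines c) (hA : A ⊆ X.strictPaths x y) :
    A ∩ X.collarPaths c' ⊆ A ∩ X.collarPaths c := by
  rintro p ⟨hp, hpc'⟩
  obtain ⟨cp, hcp, -, hfinest⟩ := exists_finest_cubeChain (hA hp)
  exact ⟨hp, (mem_collarPaths_iff_refines (hA hp) hcp).mpr (h.trans (hfinest c' hpc'))⟩

theorem refines_of_inter_collarPaths_subset (hA : X.strictTamePaths x y ⊆ A)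
    (h : A ∩ X.collarPaths c' ⊆ A ∩ X.collarPaths c) : c'.Refines c := by
  obtain ⟨p, hp, hpc⟩ := c'.exists_mem_strictTamePaths_forall_mem_collarPaths_iff
  exact (hpc c).mp (h ⟨hA hp, (hpc c').mpr .refl⟩).2

theorem Refines.inter_collarPaths_ssubset (h : c'.Refines c) (hne : c' ≠ c)
    (hA : X.strictTamePaths x y ⊆ A) (hA' : A ⊆ X.strictPaths x y) :
    A ∩ X.collarPaths c' ⊂ A ∩ X.collarPaths c :=
  ⟨h.inter_collarPaths_subset hA', fun h' =>
    hne (h.antisymm (refines_of_inter_collarPaths_subset hA h'))⟩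

theorem IsCommonRefinement.inter_collarPaths_subset (h : d.IsCommonRefinement c c')
    (hA : A ⊆ X.strictPaths x y) :
    A ∩ X.collarPaths d ⊆ (A ∩ X.collarPaths c) ∩ (A ∩ X.collarPaths c') :=
  subset_inter (h.1.inter_collarPaths_subset hA) (h.2.inter_collarPaths_subset hA)

theorem exists_isCommonRefinement_of_nonempty (hA : A ⊆ X.strictPaths x y)
    (h : ((A ∩ X.collarPaths c) ∩ (A ∩ X.collarPaths c')).Nonempty) :
    ∃ d : X.CubeChain x y, d.IsCommonRefinement c c' := by
  obtain ⟨p, ⟨hp, hpc⟩, -, hpc'⟩ := h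
  obtain ⟨cp, -, -, hfinest⟩ := exists_finest_cubeChain (hA hp)
  exact ⟨cp, hfinest c hpc, hfinest c' hpc'⟩

theorem IsCommonRefinement.inter_collarPaths_nonempty (h : d.IsCommonRefinement c c')
    (hA : X.strictTamePaths x y ⊆ A) :
    ((A ∩ X.collarPaths c) ∩ (A ∩ X.collarPaths c')).Nonempty := by
  obtain ⟨p, hp, hpd⟩ := d.exists_mem_strictTamePaths_forall_mem_collarPaths_iff
  exact ⟨p, ⟨hA hp, (hpd c).mpr h.1⟩, hA hp, (hpd c').mpr h.2⟩

theorem IsCoarsestCommonRefinement.inter_collarPaths_eq (h : d.IsCoarsestCommonRefinement c c')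
    (hA : A ⊆ X.strictPaths x y) :
    A ∩ X.collarPaths d = (A ∩ X.collarPaths c) ∩ (A ∩ X.collarPaths c') := by
  refine (h.1.inter_collarPaths_subset hA).antisymm ?_
  rintro p ⟨⟨hp, hpc⟩, -, hpc'⟩
  obtain ⟨cp, hcp, -, hfinest⟩ := exists_finest_cubeChain (hA hp)
  exact ⟨hp, (mem_collarPaths_iff_refines (hA hp) hcp).mpr
    (h.2 cp ⟨hfinest c hpc, hfinest c' hpc'⟩)⟩

end CubeChain

end PrecubicalSet

theorem mainTheorem8_general (X : PrecubicalSet.{u}) (x y : X.cube 0) :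
    (∀ A : Set C(unitInterval, X.Realization),
      X.strictTamePaths x y ⊆ A → A ⊆ X.strictPaths x y →
      (∀ c c' : X.CubeChain x y,
        c'.Refines c ↔ A ∩ X.collarPaths c' ⊆ A ∩ X.collarPaths c) ∧
      (∀ c c' : X.CubeChain x y, c'.Refines c → c' ≠ c →
        A ∩ X.collarPaths c' ⊂ A ∩ X.collarPaths c) ∧
      (∀ p ∈ A, ∃ cp : X.CubeChain x y, cp.cubes = X.crossingCubes p ∧
        p ∈ A ∩ X.collarPaths cp ∧
        ∀ c : X.CubeChain x y, p ∈ A ∩ X.collarPaths c → cp.Refines c) ∧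
      (∀ c c' : X.CubeChain x y,
        ((A ∩ X.collarPaths c) ∩ (A ∩ X.collarPaths c')).Nonempty ↔
          ∃ d : X.CubeChain x y, d.IsCommonRefinement c c') ∧
      (∀ c c' d : X.CubeChain x y, d.IsCommonRefinement c c' →
        A ∩ X.collarPaths d ⊆ (A ∩ X.collarPaths c) ∩ (A ∩ X.collarPaths c')) ∧
      (∀ c c' d : X.CubeChain x y, d.IsCoarsestCommonRefinement c c' →
        A ∩ X.collarPaths d = (A ∩ X.collarPaths c) ∩ (A ∩ X.collarPaths c')) ∧
      (X.IsProper → ∀ c c' : X.CubeChain x y,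
        (¬ ∃ d : X.CubeChain x y, d.IsCommonRefinement c c') ∨
        ∃ d : X.CubeChain x y, d.IsCoarsestCommonRefinement c c' ∧
          A ∩ X.collarPaths d = (A ∩ X.collarPaths c) ∩ (A ∩ X.collarPaths c'))) ∧
    (X.NonSelfLinked → ∀ c : X.CubeChain x y, X.collarPaths c = X.plainCollarPaths c) := by
  refine ⟨fun A hA hA' => ⟨fun c c' => ⟨fun h => h.inter_collarPaths_subset hA',
    PrecubicalSet.CubeChain.refines_of_inter_collarPaths_subset hA⟩,
    fun c c' h hne => h.inter_collarPaths_ssubset hne hA hA', fun p hp => ?_,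
    fun c c' => ⟨PrecubicalSet.CubeChain.exists_isCommonRefinement_of_nonempty hA', ?_⟩,
    fun c c' d h => h.inter_collarPaths_subset hA', fun c c' d h => h.inter_collarPaths_eq hA',
    fun hX c c' => or_iff_not_imp_left.mpr fun h => ?_⟩, fun hX c => hX.collarPaths_eq c⟩
  · obtain ⟨cp, hcp, hmem, hfinest⟩ := PrecubicalSet.exists_finest_cubeChain (hA' hp)
    exact ⟨cp, hcp, ⟨hp, hmem⟩, fun c hc => hfinest c hc.2⟩
  · rintro ⟨d, hd⟩
    exact hd.inter_collarPaths_nonempty hA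
  · obtain ⟨d, hd⟩ := not_not.mp h
    obtain ⟨e, he⟩ := hX.exists_isCoarsestCommonRefinement hd
    exact ⟨e, he, he.inter_collarPaths_eq hA'⟩

theorem mainTheorem8 (X : PrecubicalSet.{u}) (x y : X.cube 0) :
    -- all assertions hold for strict paths and for strict tame paths
    (∀ A : Set C(unitInterval, X.Realization),
      (A = X.strictPaths x y ∨ A = X.strictTamePaths x y) →
      -- refinement and inclusion
      (∀ c c' : X.CubeChain x y,
        c'.Refines c ↔ A ∩ X.collarPaths c' ⊆ A ∩ X.collarPaths c) ∧
      -- proper refinement and proper inclusion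
      (∀ c c' : X.CubeChain x y, c'.Refines c → c' ≠ c →
        A ∩ X.collarPaths c' ⊂ A ∩ X.collarPaths c) ∧
      -- the chain of a path is the finest chain whose collar path space contains the path
      (∀ p ∈ A, ∃ cp : X.CubeChain x y, cp.cubes = X.crossingCubes p ∧
        p ∈ A ∩ X.collarPaths cp ∧
        ∀ c : X.CubeChain x y, p ∈ A ∩ X.collarPaths c → cp.Refines c) ∧
      -- intersection and common refinement
      (∀ c c' : X.CubeChain x y,
        ((A ∩ X.collarPaths c) ∩ (A ∩ X.collarPaths c')).Nonempty ↔
          ∃ d : X.CubeChain x y, d.IsCommonRefinement c c') ∧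
      (∀ c c' d : X.CubeChain x y, d.IsCommonRefinement c c' →
        A ∩ X.collarPaths d ⊆ (A ∩ X.collarPaths c) ∩ (A ∩ X.collarPaths c')) ∧
      (∀ c c' d : X.CubeChain x y, d.IsCoarsestCommonRefinement c c' →
        A ∩ X.collarPaths d = (A ∩ X.collarPaths c) ∩ (A ∩ X.collarPaths c')) ∧
      -- existence of coarsest common refinements
      (X.IsProper → X.NonSelfLinked → ∀ c c' : X.CubeChain x y,
        (¬ ∃ d : X.CubeChain x y, d.IsCommonRefinement c c') ∨
        ∃ d : X.CubeChain x y, d.IsCoarsestCommonRefinement c c' ∧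
          A ∩ X.collarPaths d = (A ∩ X.collarPaths c) ∩ (A ∩ X.collarPaths c'))) ∧
    -- without self-links, collar path spaces can be described by subsets of the realization
    (X.NonSelfLinked → ∀ c : X.CubeChain x y, X.collarPaths c = X.plainCollarPaths c) := by
  refine ⟨fun A hA => ?_, (mainTheorem8_general X x y).2⟩
  have hA' : X.strictTamePaths x y ⊆ A ∧ A ⊆ X.strictPaths x y := by
    rcases hA with rfl | rfl
    exacts [⟨inter_subset_left, subset_rfl⟩, ⟨subset_rfl, inter_subset_left⟩]
  obtain ⟨h₁, h₂, h₃, h₄, h₅, h₆, h₇⟩ := (mainTheorem8_general X x y).1 A hA'.1 hA'.2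
  exact ⟨h₁, h₂, h₃, h₄, h₅, h₆, fun hX _ => h₇ hX⟩
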